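/- Let $K$ be a field of characteristic $0$ which is complete with respect to a discrete (non-trivial, non-archimedean) absolute value $|\cdot|$, with ring of integers $\mathcal O_K$, maximal ideal $\mathfrak m_K$ and residue field $k=\mathcal O_K/\mathfrak m_K$ of characteristic $\neq 2$. Let $d\in\mathcal O_K$ be a non-square in $K$ with $d(d-1)\not\equiv 0 \pmod{\mathfrak m_K}$, and let $E_d:\ x^2+y^2=1+d\,x^2y^2$. For $F=K$ and for $F=k$ (where $d$ is replaced by its residue class, which is again a non-square) let $J^0_F(E_d)$ be the abelian group of affine $F$-rational points of $E_d$ (the point $P$ standing for the class of the divisor $P-O$) with neutral element $O=(0,1)$ and addition $$(x_P,y_P)+(x_Q,y_Q)=\left(\frac{x_Py_Q+x_Qy_P}{1+d\,x_Px_Qy_Py_Q},\ \frac{y_Py_Q-x_Px_Q}{1-d\,x_Px_Qy_Py_Q}\right).$$ Points of $J^0_K(E_d)$ have integral coordinates, and $\mathrm{Mod}:J^0_K(E_d)\to J^0_k(E_d)$ denotes the homomorphism given by reduction of the coordinates modulo $\mathfrak m_K$. Let $x_1\in\mathcal O_K^{\times}$ and $y_1\in K$ satisfy $y_1^2=\frac{4x_1^3}{1-d}$,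 and put $a'=2x_1\frac{1+d}{1-d}$, $b'=x_1^2$, $g_2=-4\left(b'-\frac{a'^2}{3}\right)$, $g_3=-4\left(\frac{2a'^3}{27}-\frac{a'b'}{3}\right)$. Let $$\wp(z)=\frac1{z^2}+\sum_{j\ge2}c_jz^{2j-2},\qquad \wp'(z)=-\frac2{z^3}+\sum_{j\ge2}(2j-2)c_jz^{2j-3},$$ where $c_2=\frac{g_2}{20}$, $c_3=\frac{g_3}{28}$ and $c_j=\frac{3}{(2j+1)(j-3)}\sum_{m=2}^{j-2}c_mc_{j-m}$ for $j\ge4$. (1) If $k$ has characteristic $0$, or if $k$ has characteristic $p>0$ and $|z|^{p-1}<|p|$ for all $z\in\mathfrak m_K$ (that is, the ramification index of $K$ is less than $p-1$; for instance $K=\mathbb Q_p$, $p$ odd), then the series in $\wp(z)$ and $\wp'(z)$ converge for every $z\in\mathfrak m_K$. (2) Whenever these series converge for every $z\in\mathfrak m_K$, the following holds. For $0\ne z\in\mathfrak m_K$ one has $\wp'(z)\ne0$ and $3\wp(z)-a'+3x_1\neq0$, and setting $\mathrm{Exp}(0)=O$ and $$\mathrm{Exp}(z)=\left(\frac23\,\frac{y_1(3\wp(z)-a')}{x_1\wp'(z)},\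 \frac{3\wp(z)-a'-3x_1}{3\wp(z)-a'+3x_1}\right)\qquad(0\ne z\in\mathfrak m_K)$$ defines a homomorphism $\mathrm{Exp}:(\mathfrak m_K,+)\to J^0_K(E_d)$ such that $$0\longrightarrow\mathfrak m_K\xrightarrow{\ \mathrm{Exp}\ }J^0_K(E_d)\xrightarrow{\ \mathrm{Mod}\ }J^0_k(E_d)\longrightarrow0$$ is a short exact sequence of abelian groups. -/

import Mathlib

noncomputable section

namespace Edwards

/-! ### The group of affine points of an Edwards curve with non-square parameter -/

/-- The set `J⁰_F(E_d)` for the Edwards curve `E_d : x² + y² = 1 + d x² y²` over a field `F`, with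
`d` a non-square of `F`: the class of the divisor `P - O`, `O = (0, 1)`, is identified with the
affine `F`-rational point `P = (x, y)`.
(A non-square `d` satisfies `d (d - 1) ≠ 0`, since `0` and `1` are squares.) -/
@[ext]
structure J0 {F : Type*} [Field F] (d : F) (hd : ¬ IsSquare d) where
  x : F
  y : F
  on_curve : x ^ 2 + y ^ 2 = 1 + d * x ^ 2 * y ^ 2

section Group

theorem assoc_aux_x {F : Type*} [CommRing F] {d a b p q u v : F} (h1 : a ^ 2 + b ^ 2 = 1 + d * a ^ 2 * b ^ 2)
    (h2 : p ^ 2 + q ^ 2 = 1 + d * p ^ 2 * q ^ 2) (h3 : u ^ 2 + v ^ 2 = 1 + d * u ^ 2 * v ^ 2) :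
    ((a*q+p*b)*(1-d*a*p*b*q)*v + u*((b*q-a*p)*(1+d*a*p*b*q)))
        * ((1+d*p*u*q*v)*(1-d*p*u*q*v) + d*a*(p*v+u*q)*b*(q*v-p*u))
        = (a*((q*v-p*u)*(1+d*p*u*q*v)) + (p*v+u*q)*(1-d*p*u*q*v)*b)
          * ((1+d*a*p*b*q)*(1-d*a*p*b*q) + d*(a*q+p*b)*u*(b*q-a*p)*v) := by
  grind

theorem assoc_aux_y {F : Type*} [CommRing F] {d a b p q u v : F} (h1 : a ^ 2 + b ^ 2 = 1 + d * a ^ 2 * b ^ 2)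
    (h2 : p ^ 2 + q ^ 2 = 1 + d * p ^ 2 * q ^ 2) (h3 : u ^ 2 + v ^ 2 = 1 + d * u ^ 2 * v ^ 2) :
    ((b*q-a*p)*(1+d*a*p*b*q)*v - (a*q+p*b)*(1-d*a*p*b*q)*u)
        * ((1+d*p*u*q*v)*(1-d*p*u*q*v) - d*a*(p*v+u*q)*b*(q*v-p*u))
        = (b*((q*v-p*u)*(1+d*p*u*q*v)) - a*((p*v+u*q)*(1-d*p*u*q*v)))
          * ((1+d*a*p*b*q)*(1-d*a*p*b*q) - d*(a*q+p*b)*u*(b*q-a*p)*v) := by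
  grind

theorem closure_aux {F : Type*} [CommRing F] {d a b p q : F} (h1 : a ^ 2 + b ^ 2 = 1 + d * a ^ 2 * b ^ 2)
    (h2 : p ^ 2 + q ^ 2 = 1 + d * p ^ 2 * q ^ 2) :
    (a * q + p * b) ^ 2 * (1 - d * a * p * b * q) ^ 2
            + (b * q - a * p) ^ 2 * (1 + d * a * p * b * q) ^ 2
            = (1 - d * a * p * b * q) ^ 2 * (1 + d * a * p * b * q) ^ 2
              + d * (a * q + p * b) ^ 2 * (b * q - a * p) ^ 2 := by
  grind

variable {F : Type*} [Field F] {d : F}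

/-- The denominators of the addition law do not vanish when `d` is a non-square. -/
theorem denominator_aux (hd : ¬ IsSquare d) {a b p q e : F} (h1 : a ^ 2 + b ^ 2 = 1 + d * a ^ 2 * b ^ 2)
    (h2 : p ^ 2 + q ^ 2 = 1 + d * p ^ 2 * q ^ 2) (he : e ^ 2 = 1)
    (h : d * a * p * b * q = e) : False := by
  have hd0 : d ≠ 0 := by rintro rfl; exact hd ⟨0, by simp⟩
  have he0 : e ≠ 0 := by rintro rfl; simp at he
  have ha : a ≠ 0 := by rintro rfl; apply he0; rw [← h]; ring
  have hb : b ≠ 0 := by rintro rfl; apply he0; rw [← h]; ring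
  have hp : p ≠ 0 := by rintro rfl; apply he0; rw [← h]; ring
  have hq : q ≠ 0 := by rintro rfl; apply he0; rw [← h]; ring
  have key1 : (a + e * b) ^ 2 = d * (a * b * (p + q)) ^ 2 := by
    linear_combination h1 - d * a ^ 2 * b ^ 2 * h2 + (b ^ 2 - 1) * he
      - (2 * a * b + d * a * p * b * q + e) * h
  have key2 : (a - e * b) ^ 2 = d * (a * b * (p - q)) ^ 2 := by
    linear_combination h1 - d * a ^ 2 * b ^ 2 * h2 + (b ^ 2 - 1) * he
      + (2 * a * b - d * a * p * b * q - e) * h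
  have sq : ∀ u v : F, v ≠ 0 → u ^ 2 = d * v ^ 2 → False := fun u v hv huv =>
    hd ⟨u / v, by field_simp; exact huv.symm⟩
  by_cases h3 : p + q = 0
  · by_cases h4 : p - q = 0
    · have hpq : p = q := by linear_combination h4
      have h5 : (1 : F) ^ 2 = d * (p * q) ^ 2 := by grind
      exact sq _ _ (mul_ne_zero hp hq) h5
    · exact sq _ _ (mul_ne_zero (mul_ne_zero ha hb) h4) key2
  · exact sq _ _ (mul_ne_zero (mul_ne_zero ha hb) h3) key1

variable {hd : ¬ IsSquare d}

theorem one_add_ne_zero (P Q : J0 d hd) : 1 + d * P.x * Q.x * P.y * Q.y ≠ 0 := fun h =>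
  denominator_aux hd P.on_curve Q.on_curve (e := -1) (by ring) (by linear_combination h)

theorem one_sub_ne_zero (P Q : J0 d hd) : 1 - d * P.x * Q.x * P.y * Q.y ≠ 0 := fun h =>
  denominator_aux hd P.on_curve Q.on_curve (e := 1) (by ring) (by linear_combination -h)

/-- The Edwards addition law. -/
instance : Add (J0 d hd) where
  add P Q :=
    { x := (P.x * Q.y + Q.x * P.y) / (1 + d * P.x * Q.x * P.y * Q.y)
      y := (P.y * Q.y - P.x * Q.x) / (1 - d * P.x * Q.x * P.y * Q.y)
      on_curve := by
        have h1 := P.on_curve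
        have h2 := Q.on_curve
        have h3 := one_add_ne_zero P Q
        have h4 := one_sub_ne_zero P Q
        generalize P.x = a at *
        generalize P.y = b at *
        generalize Q.x = p at *
        generalize Q.y = q at *
        have key : (a * q + p * b) ^ 2 * (1 - d * a * p * b * q) ^ 2
            + (b * q - a * p) ^ 2 * (1 + d * a * p * b * q) ^ 2
            = (1 - d * a * p * b * q) ^ 2 * (1 + d * a * p * b * q) ^ 2
              + d * (a * q + p * b) ^ 2 * (b * q - a * p) ^ 2 := closure_aux h1 h2
        generalize 1 + d * a * p * b * q = s at *
        generalize 1 - d * a * p * b * q = t at *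
        field_simp
        linear_combination key }

/-- The neutral element `O = (0, 1)`. -/
instance : Zero (J0 d hd) where
  zero := ⟨0, 1, by ring⟩

instance : Neg (J0 d hd) where
  neg P := ⟨-P.x, P.y, by linear_combination P.on_curve⟩

theorem add_x (P Q : J0 d hd) :
    (P + Q).x = (P.x * Q.y + Q.x * P.y) / (1 + d * P.x * Q.x * P.y * Q.y) := rfl

theorem add_y (P Q : J0 d hd) :
    (P + Q).y = (P.y * Q.y - P.x * Q.x) / (1 - d * P.x * Q.x * P.y * Q.y) := rfl

theorem zero_x : (0 : J0 d hd).x = 0 := rfl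

theorem zero_y : (0 : J0 d hd).y = 1 := rfl

theorem neg_x (P : J0 d hd) : (-P).x = -P.x := rfl

theorem neg_y (P : J0 d hd) : (-P).y = P.y := rfl

theorem assoc_aux (P Q R : J0 d hd) : P + Q + R = P + (Q + R) := by
  have h1 := P.on_curve
  have h2 := Q.on_curve
  have h3 := R.on_curve
  have n1 := one_add_ne_zero P Q
  have n2 := one_sub_ne_zero P Q
  have n3 := one_add_ne_zero Q R
  have n4 := one_sub_ne_zero Q R
  have m1 := one_add_ne_zero (P + Q) R
  have m2 := one_sub_ne_zero (P + Q) R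
  have m3 := one_add_ne_zero P (Q + R)
  have m4 := one_sub_ne_zero P (Q + R)
  ext
  · rw [add_x (P + Q) R, add_x P (Q + R), div_eq_div_iff m1 m3]
    clear m1 m2 m3 m4
    simp only [add_x, add_y]
    generalize P.x = a at *
    generalize P.y = b at *
    generalize Q.x = p at *
    generalize Q.y = q at *
    generalize R.x = u at *
    generalize R.y = v at *
    have key : ((a*q+p*b)*(1-d*a*p*b*q)*v + u*((b*q-a*p)*(1+d*a*p*b*q)))
        * ((1+d*p*u*q*v)*(1-d*p*u*q*v) + d*a*(p*v+u*q)*b*(q*v-p*u))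
        = (a*((q*v-p*u)*(1+d*p*u*q*v)) + (p*v+u*q)*(1-d*p*u*q*v)*b)
          * ((1+d*a*p*b*q)*(1-d*a*p*b*q) + d*(a*q+p*b)*u*(b*q-a*p)*v) := assoc_aux_x h1 h2 h3
    generalize 1 + d * a * p * b * q = s at *
    generalize 1 - d * a * p * b * q = t at *
    generalize 1 + d * p * u * q * v = s' at *
    generalize 1 - d * p * u * q * v = t' at *
    field_simp
    linear_combination key
  · rw [add_y (P + Q) R, add_y P (Q + R), div_eq_div_iff m2 m4]
    clear m1 m2 m3 m4
    simp only [add_x, add_y]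
    generalize P.x = a at *
    generalize P.y = b at *
    generalize Q.x = p at *
    generalize Q.y = q at *
    generalize R.x = u at *
    generalize R.y = v at *
    have key : ((b*q-a*p)*(1+d*a*p*b*q)*v - (a*q+p*b)*(1-d*a*p*b*q)*u)
        * ((1+d*p*u*q*v)*(1-d*p*u*q*v) - d*a*(p*v+u*q)*b*(q*v-p*u))
        = (b*((q*v-p*u)*(1+d*p*u*q*v)) - a*((p*v+u*q)*(1-d*p*u*q*v)))
          * ((1+d*a*p*b*q)*(1-d*a*p*b*q) - d*(a*q+p*b)*u*(b*q-a*p)*v) := assoc_aux_y h1 h2 h3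
    generalize 1 + d * a * p * b * q = s at *
    generalize 1 - d * a * p * b * q = t at *
    generalize 1 + d * p * u * q * v = s' at *
    generalize 1 - d * p * u * q * v = t' at *
    field_simp
    linear_combination key

/-- The Edwards addition law makes the affine points an abelian group. -/
instance : AddCommGroup (J0 d hd) where
  add_assoc := assoc_aux
  zero_add P := by ext <;> simp [add_x, add_y, zero_x, zero_y]
  add_zero P := by ext <;> simp [add_x, add_y, zero_x, zero_y]
  nsmul := nsmulRec
  zsmul := zsmulRec
  neg_add_cancel P := by
    have h := one_sub_ne_zero (-P) P
    ext
    · simp only [add_x, neg_x, neg_y, zero_x]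
      rw [div_eq_zero_iff]
      left
      ring
    · simp only [add_y, neg_x, neg_y, zero_y] at h ⊢
      rw [div_eq_one_iff_eq h]
      linear_combination P.on_curve
  add_comm P Q := by
    ext
    · simp only [add_x]
      congr 1 <;> ring
    · simp only [add_y]
      congr 1 <;> ring

end Group

/-! ### Ring of integers, residue field and reduction -/

section Reduction

variable (K : Type*) [NontriviallyNormedField K] [IsUltrametricDist K]

/-- The ring of integers `{x | ‖x‖ ≤ 1}` of a non-archimedean normed field. -/
abbrev ringOfIntegers : ValuationSubring K :=
  (NormedField.valuation (K := K)).valuationSubring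

/-- The maximal ideal `𝔪_K` of the ring of integers. -/
abbrev maxIdeal : Ideal (ringOfIntegers K) := IsLocalRing.maximalIdeal (ringOfIntegers K)

/-- The residue field `k` of `K`. -/
abbrev resField : Type _ := IsLocalRing.ResidueField (ringOfIntegers K)

variable {K}

/-- Reduction modulo `𝔪_K`. -/
abbrev res : ringOfIntegers K →+* resField K := IsLocalRing.residue (ringOfIntegers K)

theorem norm_sub_le_max' (x y : K) : ‖x - y‖ ≤ max ‖x‖ ‖y‖ := by
  rw [sub_eq_add_neg, ← norm_neg y]
  exact IsUltrametricDist.norm_add_le_max x (-y)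

theorem mem_ringOfIntegers {x : K} : x ∈ ringOfIntegers K ↔ ‖x‖ ≤ 1 := by
  rw [Valuation.mem_valuationSubring_iff, NormedField.valuation_apply, ← NNReal.coe_le_coe]
  simp

theorem norm_eq_one_of_res_ne_zero {x : ringOfIntegers K} (h : res x ≠ 0) : ‖(x : K)‖ = 1 := by
  have hu : IsUnit x := by simpa using h
  obtain ⟨y, hy⟩ := hu.exists_right_inv
  have h1 : ‖(x : K)‖ ≤ 1 := mem_ringOfIntegers.1 x.2
  have h2 : ‖(y : K)‖ ≤ 1 := mem_ringOfIntegers.1 y.2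
  have h3 : ‖(x : K)‖ * ‖(y : K)‖ = 1 := by
    rw [← norm_mul]
    have : (x : K) * (y : K) = 1 := by exact_mod_cast congrArg Subtype.val hy
    rw [this, norm_one]
  nlinarith [norm_nonneg (x : K)]

theorem norm_lt_one_of_res_eq_zero {x : ringOfIntegers K} (h : res x = 0) : ‖(x : K)‖ < 1 := by
  have h1 : ‖(x : K)‖ ≤ 1 := mem_ringOfIntegers.1 x.2
  refine lt_of_le_of_ne h1 fun h2 => ?_
  have hx0 : (x : K) ≠ 0 := by
    intro h0
    rw [h0, norm_zero] at h2
    exact zero_ne_one h2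
  have hy : (x : K)⁻¹ ∈ ringOfIntegers K := mem_ringOfIntegers.2 (by rw [norm_inv, h2, inv_one])
  have h3 : x * ⟨(x : K)⁻¹, hy⟩ = 1 := Subtype.ext (mul_inv_cancel₀ hx0)
  have h4 := congrArg res h3
  rw [map_mul, h, zero_mul, map_one] at h4
  exact zero_ne_one h4

/-- A `1`-unit is a square when the residue characteristic is not `2`. -/
theorem isSquare_of_norm_sub_one_lt [CompleteSpace K] (h2 : ‖(2 : K)‖ = 1) {u : K}
    (hu : ‖u - 1‖ < 1) : IsSquare u := by
  have h20 : (2 : K) ≠ 0 := by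
    intro h
    rw [h, norm_zero] at h2
    exact zero_ne_one h2
  let f : K → K := fun t => (u - 1 - t ^ 2) / 2
  let s : Set K := Metric.closedBall 0 ‖u - 1‖
  have hs : ∀ {t : K}, t ∈ s ↔ ‖t‖ ≤ ‖u - 1‖ := by simp [s]
  have hmap : Set.MapsTo f s s := by
    intro t ht
    rw [hs] at ht ⊢
    simp only [f, norm_div, h2, div_one]
    refine (norm_sub_le_max' _ _).trans (max_le le_rfl ?_)
    rw [norm_pow]
    nlinarith [norm_nonneg t]
  have hcontr : ContractingWith ‖u - 1‖₊ (hmap.restrict f s s) := by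
    refine ⟨by exact_mod_cast hu, LipschitzWith.of_dist_le_mul fun a b => ?_⟩
    have ha := hs.1 a.2
    have hb := hs.1 b.2
    change dist (f a) (f b) ≤ ‖u - 1‖ * dist (a : K) (b : K)
    rw [dist_eq_norm, dist_eq_norm]
    have : f a - f b = -(((a : K) + b) * (a - b)) / 2 := by simp only [f]; ring
    rw [this, norm_div, h2, div_one, norm_neg, norm_mul]
    refine mul_le_mul_of_nonneg_right ?_ (norm_nonneg _)
    exact (IsUltrametricDist.norm_add_le_max _ _).trans (max_le ha hb)
  obtain ⟨t, -, ht, -⟩ := hcontr.exists_fixedPoint' (Metric.isClosed_closedBall.isComplete) hmap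
    (x := 0) (hs.2 (by simp)) (edist_ne_top _ _)
  have ht' : (u - 1 - t ^ 2) / 2 = t := ht
  rw [div_eq_iff h20] at ht'
  exact ⟨1 + t, by linear_combination ht'⟩

/-- If `d` is a unit and a non-square in `K`, then it stays a non-square in the residue field. -/
theorem res_not_isSquare [CompleteSpace K] (h2 : (2 : resField K) ≠ 0) {d : ringOfIntegers K}
    (hd0 : res d ≠ 0) (hd : ¬ IsSquare (d : K)) : ¬ IsSquare (res d) := by
  rintro ⟨c, hc⟩
  obtain ⟨s, rfl⟩ := IsLocalRing.residue_surjective c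
  have hs0 : res s ≠ 0 := fun h => hd0 (by rw [hc]; exact mul_eq_zero_of_left h _)
  have hn2 : ‖(2 : K)‖ = 1 := by
    have := norm_eq_one_of_res_ne_zero (x := (2 : ringOfIntegers K)) (by rwa [map_ofNat])
    exact_mod_cast this
  have hns := norm_eq_one_of_res_ne_zero hs0
  have hsK : (s : K) ≠ 0 := by
    intro h0
    rw [h0, norm_zero] at hns
    exact zero_ne_one hns
  have hlt : ‖((d - s * s : ringOfIntegers K) : K)‖ < 1 :=
    norm_lt_one_of_res_eq_zero (by rw [map_sub, map_mul, hc, sub_self])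
  obtain ⟨r, hr⟩ := isSquare_of_norm_sub_one_lt hn2 (u := (d : K) / (s * s)) (by
    have : (d : K) / (s * s) - 1 = ((d - s * s : ringOfIntegers K) : K) / (s * s) := by
      push_cast
      field_simp
    rw [this, norm_div, norm_mul, hns]
    simpa using hlt)
  apply hd
  refine ⟨s * r, ?_⟩
  rw [div_eq_iff (mul_ne_zero hsK hsK)] at hr
  rw [hr]
  ring

variable {d : ringOfIntegers K}

theorem integral_aux (hr : ¬ IsSquare (res d)) {x y : K}
    (h : x ^ 2 + y ^ 2 = 1 + d * x ^ 2 * y ^ 2) (hy : ‖y‖ ≤ 1) : ‖x‖ ≤ 1 := by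
  let Y : ringOfIntegers K := ⟨y, mem_ringOfIntegers.2 hy⟩
  have h1 : res (1 - d * Y ^ 2) ≠ 0 := by
    intro h0
    rw [map_sub, map_mul, map_pow, map_one, sub_eq_zero] at h0
    have hY : res Y ≠ 0 := by
      intro hY
      rw [hY] at h0
      simp at h0
    exact hr ⟨(res Y)⁻¹, by field_simp; exact h0.symm⟩
  have h2 := norm_eq_one_of_res_ne_zero h1
  have h3 : x ^ 2 * ((1 - d * Y ^ 2 : ringOfIntegers K) : K) = 1 - y ^ 2 := by
    push_cast
    linear_combination h
  have h4 : ‖x‖ ^ 2 ≤ 1 := by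
    have := congrArg norm h3
    rw [norm_mul, h2, mul_one, norm_pow] at this
    rw [this]
    refine (norm_sub_le_max' _ _).trans (max_le (by simp) ?_)
    rw [norm_pow]
    exact pow_le_one₀ (norm_nonneg _) hy
  nlinarith [norm_nonneg x]

/-- The affine `K`-points of an Edwards curve with good reduction and `d` a non-square modulo `𝔪_K`
have integral first coordinate. -/
theorem norm_x_le_one {hd : ¬ IsSquare (d : K)} (hr : ¬ IsSquare (res d)) (P : J0 (d : K) hd) :
    ‖P.x‖ ≤ 1 := by
  by_cases hy : ‖P.y‖ ≤ 1
  · exact integral_aux hr P.on_curve hy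
  · push Not at hy
    have hy0 : P.y ≠ 0 := by
      intro h0
      rw [h0, norm_zero] at hy
      linarith
    have hw : ‖(P.y)⁻¹‖ ≤ 1 := by rw [norm_inv]; exact inv_le_one_of_one_le₀ hy.le
    let W : ringOfIntegers K := ⟨(P.y)⁻¹, mem_ringOfIntegers.2 hw⟩
    have h1 : res (W ^ 2 - d) ≠ 0 := by
      intro h0
      rw [map_sub, map_pow, sub_eq_zero] at h0
      exact hr ⟨res W, by rw [← h0]; ring⟩
    have h2 := norm_eq_one_of_res_ne_zero h1
    have h3 : P.x ^ 2 * ((W ^ 2 - d : ringOfIntegers K) : K) = (P.y)⁻¹ ^ 2 - 1 := by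
      push_cast
      change P.x ^ 2 * ((P.y)⁻¹ ^ 2 - d) = _
      field_simp
      linear_combination P.on_curve
    have h4 : ‖P.x‖ ^ 2 ≤ 1 := by
      have := congrArg norm h3
      rw [norm_mul, h2, mul_one, norm_pow] at this
      rw [this]
      refine (norm_sub_le_max' _ _).trans (max_le ?_ (by simp))
      rw [norm_pow]
      exact pow_le_one₀ (norm_nonneg _) hw
    nlinarith [norm_nonneg P.x]

theorem norm_y_le_one {hd : ¬ IsSquare (d : K)} (hr : ¬ IsSquare (res d)) (P : J0 (d : K) hd) :
    ‖P.y‖ ≤ 1 :=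
  integral_aux (x := P.y) (y := P.x) hr (by linear_combination P.on_curve) (norm_x_le_one hr P)

/-- The reduction map `Mod : J⁰_K(E_d) → J⁰_k(E_d)`, `(x, y) ↦ (x mod 𝔪_K, y mod 𝔪_K)`. -/
def reduction (hd : ¬ IsSquare (d : K)) (hr : ¬ IsSquare (res d)) :
    J0 (d : K) hd →+ J0 (res d) hr where
  toFun P :=
    { x := res ⟨P.x, mem_ringOfIntegers.2 (norm_x_le_one hr P)⟩
      y := res ⟨P.y, mem_ringOfIntegers.2 (norm_y_le_one hr P)⟩
      on_curve := by
        simp only [← map_pow, ← map_mul, ← map_add, ← map_one (res (K := K))]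
        exact congrArg res (Subtype.ext P.on_curve) }
  map_zero' := by
    ext
    · exact map_zero (res (K := K))
    · exact map_one (res (K := K))
  map_add' P Q := by
    ext
    · refine Eq.trans ?_ (add_x _ _).symm
      rw [eq_div_iff (one_add_ne_zero _ _)]
      simp only [← map_mul, ← map_add, ← map_one (res (K := K))]
      refine congrArg res (Subtype.ext ?_)
      exact div_mul_cancel₀ _ (one_add_ne_zero P Q)
    · refine Eq.trans ?_ (add_y _ _).symm
      rw [eq_div_iff (one_sub_ne_zero _ _)]
      simp only [← map_mul, ← map_sub, ← map_one (res (K := K))]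
      refine congrArg res (Subtype.ext ?_)
      exact div_mul_cancel₀ _ (one_sub_ne_zero P Q)

end Reduction

/-! ### The Weierstrass function as a Laurent series, and the exponential map -/

section Exp

variable {K : Type*} [NontriviallyNormedField K]

/-- The coefficients `c_k` of `℘(z) = z⁻² + ∑_{k ≥ 2} c_k z^(2k-2)`:
`c_2 = g₂/20`, `c_3 = g₃/28`, `c_k = 3/((2k+1)(k-3)) ∑_{m=2}^{k-2} c_m c_{k-m}` for `k ≥ 4`
(in the last clause `k = n + 4` and `m = i + 2`). -/
def wpCoeff (g₂ g₃ : K) : ℕ → K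
  | 0 => 0
  | 1 => 0
  | 2 => g₂ / 20
  | 3 => g₃ / 28
  | n + 4 => 3 / ((2 * ((n : K) + 4) + 1) * (((n : K) + 4) - 3)) *
      ∑ i : Fin (n + 1), wpCoeff g₂ g₃ (i + 2) * wpCoeff g₂ g₃ (n + 2 - i)
decreasing_by all_goals omega

/-- Terms of the regular part of `℘`, with `k = j + 2`. -/
def wpTerm (g₂ g₃ z : K) (j : ℕ) : K := wpCoeff g₂ g₃ (j + 2) * z ^ (2 * j + 2)

/-- Terms of the regular part of `℘'`, with `k = j + 2`. -/
def wpDerivTerm (g₂ g₃ z : K) (j : ℕ) : K :=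
  (2 * (j : K) + 2) * wpCoeff g₂ g₃ (j + 2) * z ^ (2 * j + 1)

/-- `℘(z)` as the sum of its Laurent series. -/
def wp (g₂ g₃ z : K) : K := 1 / z ^ 2 + ∑' j, wpTerm g₂ g₃ z j

/-- `℘'(z)` as the sum of its Laurent series. -/
def wpDeriv (g₂ g₃ z : K) : K := -2 / z ^ 3 + ∑' j, wpDerivTerm g₂ g₃ z j

/-- The (regular parts of the) Laurent series of `℘` and `℘'` converge at `z`. -/
def WpConvergesAt (g₂ g₃ z : K) : Prop :=
  Summable (wpTerm g₂ g₃ z) ∧ Summable (wpDerivTerm g₂ g₃ z)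

/-- `a' = 2 x₁ (1 + d) / (1 - d)`. -/
def aPrime (d x₁ : K) : K := 2 * x₁ * ((1 + d) / (1 - d))

/-- `b' = x₁²`. -/
def bPrime (x₁ : K) : K := x₁ ^ 2

/-- `g₂ = -4 a`, where `Y² = X³ + a X + b` is the short Weierstrass form obtained from
`y² = x³ + a' x² + b' x` by `x = X - a'/3`, `y = Y`; here `a = b' - a'²/3`. -/
def g2 (d x₁ : K) : K := -4 * (bPrime x₁ - aPrime d x₁ ^ 2 / 3)

/-- `g₃ = -4 b`, with `b = 2 a'³/27 - a' b'/3`. -/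
def g3 (d x₁ : K) : K := -4 * (2 * aPrime d x₁ ^ 3 / 27 - aPrime d x₁ * bPrime x₁ / 3)

/-- First coordinate of `Exp(z)` for `z ≠ 0`. -/
def expX (d x₁ y₁ z : K) : K :=
  2 / 3 * (y₁ * (3 * wp (g2 d x₁) (g3 d x₁) z - aPrime d x₁) /
    (x₁ * wpDeriv (g2 d x₁) (g3 d x₁) z))

/-- Second coordinate of `Exp(z)` for `z ≠ 0`. -/
def expY (d x₁ z : K) : K :=
  (3 * wp (g2 d x₁) (g3 d x₁) z - aPrime d x₁ - 3 * x₁) /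
    (3 * wp (g2 d x₁) (g3 d x₁) z - aPrime d x₁ + 3 * x₁)

end Exp

end Edwards

end

/-!
Put `x = ℘ - a' / 3`, so that `(x, x' / 2)` lies on `y² = x³ + a' x² + b' x`, and write
`F = z² x(z)` and `G = -z³ x'(z) / 2`. These are power series with constant coefficient `1`
(`xSeries`, `ySeries`), and the recursion for the `c_k` says that they satisfy the two differential
equations of the Weierstrass function. With `κ = -y₁ / x₁`, hence `κ² (1 - d) = 4 x₁`, the
coordinates of `Exp` become the power series `u = κ z F / G` and
`v = (F - x₁ z²) / (F + x₁ z²)`. They lie on the Edwards curve and form an integral curve of its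
invariant vector field: `u' = κ v (1 - d u²)` and `v' = -κ u (1 - d v²)`.

*Additivity.* For fixed `z` and `w`, the point `(u, v)(t (z + w))` and the sum of the points
`(u, v)(t z)` and `(u, v)(t w)` are formal integral curves in `t` with the same speed and the same
initial point, so they agree (`rescale_add_uSeries_vSeries`). Convergent identities in `t` may be
evaluated at `t = 1` by the ring homomorphism `evalOne`.

*Convergence for small ramification.* The vector field has integral coefficients, so the `n`-th
derivatives of `u` and `v` at `0` are integral; dividing by `n!` they converge as well as the
exponential series. Since `F` can be recovered from `u / (κ z)` and `v` by integral operations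
(`xSeries_eq_edwards`), the same holds for `F`.

*Size of the coefficients.* Suppose that the series converge at a uniformizer `ϖ`. Then the
coefficients of `F(ϖ s)` tend to `0`; comparing the extreme coefficients in `G² = F³ + ⋯`
shows that they all have norm less than `1` except the constant one
(`ConvergentExp.isPrincipalUnit_rescale_uniformizer_xSeries`). Hence `F` and `G` take unit values on
the maximal ideal, which gives the two non-vanishing assertions, and `u` is `κ z` up to a
contraction, so that `z ↦ u(z)` is a norm-preserving bijection of the maximal ideal. This gives
injectivity, and exactness in the middle because a point in the kernel of reduction is determined by
its first coordinate (`eq_of_x_eq`). Surjectivity of the reduction is Hensel's lemma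
(`reduction_surjective`).
-/

noncomputable section

namespace Edwards

open PowerSeries Filter Topology
open Finset.HasAntidiagonal (antidiagonal mem_antidiagonal)

/-! ### Power series over a complete non-archimedean field -/

section GaussNorm

variable {K : Type*} [NormedField K]

/-- `N` is the last index at which the coefficients of `f` attain their maximal norm. -/
structure IsLastMaxIndex (f : K⟦X⟧) (N : ℕ) : Prop where
  le : ∀ n, ‖coeff n f‖ ≤ ‖coeff N f‖
  lt : ∀ n, N < n → ‖coeff n f‖ < ‖coeff N f‖

theorem IsLastMaxIndex.exists_of_tendsto {f : K⟦X⟧} (hf : f ≠ 0)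
    (h : Tendsto (fun n => coeff n f) atTop (𝓝 0)) : ∃ N, IsLastMaxIndex f N := by
  obtain ⟨m, hm⟩ : ∃ m, coeff m f ≠ 0 := by
    by_contra! h0
    exact hf (PowerSeries.ext (by simpa using h0))
  have hfin : {n | ‖coeff m f‖ ≤ ‖coeff n f‖}.Finite := by
    have h1 : ∀ᶠ n in cofinite, ‖coeff n f‖ < ‖coeff m f‖ := by
      rw [Nat.cofinite_eq_atTop]
      exact (tendsto_zero_iff_norm_tendsto_zero.1 h).eventually_lt_const (norm_pos_iff.2 hm)
    simpa [Filter.eventually_cofinite] using h1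
  obtain ⟨N, hN, hmax⟩ := hfin.toFinset.exists_max_image
    (fun n => toLex (‖coeff n f‖, n)) ⟨m, by simp⟩
  have hN' : ‖coeff m f‖ ≤ ‖coeff N f‖ := by simpa using hN
  have key : ∀ n, ‖coeff n f‖ < ‖coeff N f‖ ∨ ‖coeff n f‖ = ‖coeff N f‖ ∧ n ≤ N := by
    intro n
    by_cases hn : ‖coeff m f‖ ≤ ‖coeff n f‖
    · have := hmax n (by simpa using hn)
      rwa [Prod.Lex.toLex_le_toLex] at this
    · exact Or.inl (lt_of_lt_of_le (not_le.1 hn) hN')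
  refine ⟨N, fun n => ?_, fun n hn => ?_⟩
  · rcases key n with h1 | h1
    · exact h1.le
    · exact h1.1.le
  · rcases key n with h1 | h1
    · exact h1
    · omega

variable [IsUltrametricDist K]

theorem norm_sum_lt_of_forall_lt {ι : Type*} {s : Finset ι} {f : ι → K} {c : ℝ} (hc : 0 < c)
    (h : ∀ i ∈ s, ‖f i‖ < c) : ‖∑ i ∈ s, f i‖ < c := by
  induction s using Finset.cons_induction with
  | empty => simpa
  | cons a s ha ih =>
    rw [Finset.sum_cons]
    exact (IsUltrametricDist.norm_add_le_max _ _).trans_lt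
      (max_lt (h a (by simp)) (ih fun i hi => h i (by simp [hi])))

/-- Submultiplicativity of the Gauss norm of radius `r`, coefficientwise. -/
theorem norm_coeff_mul_mul_pow_le {r a b : ℝ} (hr : 0 ≤ r) (ha : 0 ≤ a) (hb : 0 ≤ b) {f g : K⟦X⟧}
    (hf : ∀ n, ‖coeff n f‖ * r ^ n ≤ a) (hg : ∀ n, ‖coeff n g‖ * r ^ n ≤ b) (n : ℕ) :
    ‖coeff n (f * g)‖ * r ^ n ≤ a * b := by
  obtain hrn | hrn := (pow_nonneg hr n).eq_or_lt
  · rw [← hrn, mul_zero]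
    positivity
  rw [← le_div_iff₀ hrn, coeff_mul]
  refine IsUltrametricDist.norm_sum_le_of_forall_le_of_nonneg (by positivity) fun p hp => ?_
  rw [mem_antidiagonal] at hp
  rw [le_div_iff₀ hrn, norm_mul, ← hp, pow_add]
  calc _ = (‖coeff p.1 f‖ * r ^ p.1) * (‖coeff p.2 g‖ * r ^ p.2) := by ring
    _ ≤ a * b := mul_le_mul (hf _) (hg _) (by positivity) ha

theorem norm_coeff_add_mul_pow_le {r a : ℝ} (hr : 0 ≤ r) {f g : K⟦X⟧}
    (hf : ∀ n, ‖coeff n f‖ * r ^ n ≤ a) (hg : ∀ n, ‖coeff n g‖ * r ^ n ≤ a) (n : ℕ) :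
    ‖coeff n (f + g)‖ * r ^ n ≤ a := by
  rw [map_add]
  refine (mul_le_mul_of_nonneg_right (IsUltrametricDist.norm_add_le_max _ _)
    (pow_nonneg hr n)).trans ?_
  rw [max_mul_of_nonneg _ _ (pow_nonneg hr n)]
  exact max_le (hf n) (hg n)

/-- A power series of Gauss norm at most `1` whose constant coefficient is a unit has an inverse
of Gauss norm at most `1`. -/
theorem norm_coeff_inv_mul_pow_le_one {r : ℝ} (hr : 0 ≤ r) {f : K⟦X⟧}
    (h0 : ‖constantCoeff f‖ = 1) (hf : ∀ n, ‖coeff n f‖ * r ^ n ≤ 1) (n : ℕ) :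
    ‖coeff n f⁻¹‖ * r ^ n ≤ 1 := by
  induction n using Nat.strong_induction_on with
  | _ n ih =>
    rw [PowerSeries.coeff_inv]
    split_ifs with hn
    · simp [h0, hn]
    obtain hrn | hrn := (pow_nonneg hr n).eq_or_lt
    · rw [← hrn, mul_zero]
      exact zero_le_one
    rw [norm_mul, norm_neg, norm_inv, h0, inv_one, one_mul, ← le_div_iff₀ hrn]
    refine IsUltrametricDist.norm_sum_le_of_forall_le_of_nonneg (by positivity) fun p hp => ?_
    rw [mem_antidiagonal] at hp
    split_ifs with hlt
    · rw [le_div_iff₀ hrn, norm_mul, ← hp, pow_add]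
      calc _ = (‖coeff p.1 f‖ * r ^ p.1) * (‖coeff p.2 f⁻¹‖ * r ^ p.2) := by ring
        _ ≤ 1 * 1 := mul_le_mul (hf _) (ih _ hlt) (by positivity) zero_le_one
        _ = 1 := one_mul 1
    · rw [norm_zero]
      positivity

theorem IsLastMaxIndex.norm_coeff_mul {f g : K⟦X⟧} {M N : ℕ} (hf : IsLastMaxIndex f M)
    (hg : IsLastMaxIndex g N) (hf0 : coeff M f ≠ 0) (hg0 : coeff N g ≠ 0) :
    ‖coeff (M + N) (f * g)‖ = ‖coeff M f‖ * ‖coeff N g‖ := by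
  have hf0 := norm_pos_iff.2 hf0
  have hg0 := norm_pos_iff.2 hg0
  rw [coeff_mul, ← Finset.add_sum_erase _ _ (show (M, N) ∈ antidiagonal (M + N) by simp)]
  have hrest : ‖∑ p ∈ (antidiagonal (M + N)).erase (M, N), coeff p.1 f * coeff p.2 g‖
      < ‖coeff M f * coeff N g‖ := by
    rw [norm_mul]
    refine norm_sum_lt_of_forall_lt (by positivity) fun p hp => ?_
    simp only [Finset.mem_erase, mem_antidiagonal, ne_eq, Prod.ext_iff, not_and] at hp
    rw [norm_mul]
    rcases lt_trichotomy p.1 M with h | h | h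
    · exact mul_lt_mul' (hf.le _) (hg.lt _ (by omega)) (norm_nonneg _) hf0
    · omega
    · exact mul_lt_mul_of_lt_of_le_of_nonneg_of_pos (hf.lt _ h) (hg.le _) (norm_nonneg _) hg0
  rw [IsUltrametricDist.norm_add_eq_max_of_norm_ne_norm hrest.ne', max_eq_left hrest.le, norm_mul]

theorem IsLastMaxIndex.mul {f g : K⟦X⟧} {M N : ℕ} (hf : IsLastMaxIndex f M)
    (hg : IsLastMaxIndex g N) (hf0 : coeff M f ≠ 0) (hg0 : coeff N g ≠ 0) :
    IsLastMaxIndex (f * g) (M + N) := by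
  have key := hf.norm_coeff_mul hg hf0 hg0
  have hf0 := norm_pos_iff.2 hf0
  have hg0 := norm_pos_iff.2 hg0
  refine ⟨fun n => ?_, fun n hn => ?_⟩
  · rw [key, coeff_mul]
    refine IsUltrametricDist.norm_sum_le_of_forall_le_of_nonneg (by positivity) fun p hp => ?_
    rw [norm_mul]
    exact mul_le_mul (hf.le _) (hg.le _) (norm_nonneg _) hf0.le
  · rw [key, coeff_mul]
    refine norm_sum_lt_of_forall_lt (by positivity) fun p hp => ?_
    rw [norm_mul]
    rw [mem_antidiagonal] at hp
    rcases lt_or_ge M p.1 with h | h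
    · exact mul_lt_mul_of_lt_of_le_of_nonneg_of_pos (hf.lt _ h) (hg.le _) (norm_nonneg _) hg0
    · exact mul_lt_mul' (hf.le _) (hg.lt _ (by omega)) (norm_nonneg _) hf0

end GaussNorm

section Restricted

variable (K : Type*) [NontriviallyNormedField K] [IsUltrametricDist K]

instance nonarchimedeanRing_of_isUltrametricDist : NonarchimedeanRing K where
  is_nonarchimedean := NonarchimedeanAddGroup.is_nonarchimedean

/-- The ring `K⟨t⟩` of power series converging on the closed unit disc. Over a complete
non-archimedean field this is the ring of power series whose coefficients tend to `0`. -/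
def restrictedSeries : Subring K⟦X⟧ where
  carrier := {f | Summable fun n => coeff n f}
  mul_mem' {f g} hf hg := by
    simpa only [Set.mem_ofPred_eq, coeff_mul] using
      summable_sum_mul_antidiagonal_of_summable_mul (Summable.mul_of_nonarchimedean hf hg)
  one_mem' := summable_of_hasFiniteSupport <| (Set.finite_singleton 0).subset fun n hn => by
    by_contra h
    exact hn (by simp [coeff_one, show n ≠ 0 from h])
  add_mem' {f g} hf hg := by
    simpa only [Set.mem_ofPred_eq, map_add] using Summable.add hf hg
  zero_mem' := by simp [summable_zero]
  neg_mem' {f} hf := by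
    simpa only [Set.mem_ofPred_eq, map_neg] using Summable.neg hf

variable {K} in
theorem mem_restrictedSeries {f : K⟦X⟧} :
    f ∈ restrictedSeries K ↔ Summable fun n => coeff n f := Iff.rfl

variable {K} in
theorem tsum_coeff_mul {f g : K⟦X⟧} (hf : f ∈ restrictedSeries K) (hg : g ∈ restrictedSeries K) :
    ∑' n, coeff n (f * g) = (∑' n, coeff n f) * ∑' n, coeff n g := by
  have hf' := mem_restrictedSeries.1 hf
  have hg' := mem_restrictedSeries.1 hg
  have h := hf'.mul_of_nonarchimedean hg'
  refine (tsum_congr fun n => coeff_mul n f g).trans ?_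
  exact (hf'.tsum_mul_tsum_eq_tsum_sum_antidiagonal hg' h).symm

/-- Evaluation of a restricted power series at `1`. -/
def evalOne : restrictedSeries K →+* K where
  toFun f := ∑' n, coeff n (f : K⟦X⟧)
  map_one' := by
    rw [tsum_eq_single 0 fun n hn => by simp [coeff_one, hn]]
    simp
  map_mul' f g :=
    tsum_coeff_mul f.2 g.2
  map_zero' := by simp only [ZeroMemClass.coe_zero, map_zero, tsum_zero]
  map_add' f g := by
    simp only [Subring.coe_add, map_add]
    exact (mem_restrictedSeries.1 f.2).tsum_add (mem_restrictedSeries.1 g.2)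

variable {K}

theorem mem_restrictedSeries_iff_tendsto [CompleteSpace K] {f : K⟦X⟧} :
    f ∈ restrictedSeries K ↔ Tendsto (fun n => coeff n f) atTop (𝓝 0) := by
  refine ⟨fun h => Summable.tendsto_atTop_zero h, fun h => ?_⟩
  exact NonarchimedeanAddGroup.summable_of_tendsto_cofinite_zero (by rwa [Nat.cofinite_eq_atTop])

theorem C_mem_restrictedSeries (a : K) : C a ∈ restrictedSeries K :=
  summable_of_hasFiniteSupport <| (Set.finite_singleton 0).subset fun n hn => by
    by_contra h
    exact hn (by simp [coeff_C, show n ≠ 0 from h])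

theorem X_mem_restrictedSeries : (X : K⟦X⟧) ∈ restrictedSeries K :=
  summable_of_hasFiniteSupport <| (Set.finite_singleton 1).subset fun n hn => by
    by_contra h
    exact hn (by simp [coeff_X, show n ≠ 1 from h])

theorem evalOne_mk {f : K⟦X⟧} (hf : f ∈ restrictedSeries K) :
    evalOne K ⟨f, hf⟩ = ∑' n, coeff n f := rfl

theorem evalOne_C (a : K) : evalOne K ⟨C a, C_mem_restrictedSeries a⟩ = a := by
  rw [evalOne_mk, tsum_eq_single 0 fun n hn => by simp [coeff_C, hn]]
  simp

theorem evalOne_X : evalOne K ⟨X, X_mem_restrictedSeries⟩ = 1 := by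
  rw [evalOne_mk, tsum_eq_single 1 fun n hn => by simp [coeff_X, hn]]
  simp

theorem norm_evalOne_le {f : restrictedSeries K} {c : ℝ} (hc : 0 ≤ c)
    (h : ∀ n, ‖coeff n (f : K⟦X⟧)‖ ≤ c) : ‖evalOne K f‖ ≤ c :=
  IsUltrametricDist.norm_tsum_le_of_forall_le_of_nonneg hc h

/-- `f` is restricted and congruent to `1` modulo the elements of norm at most `c`. For `c < 1`
such series form a group under multiplication. -/
structure IsPrincipalUnit (c : ℝ) (f : K⟦X⟧) : Prop where
  mem : f ∈ restrictedSeries K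
  norm_le : ∀ n, ‖coeff n (f - 1)‖ ≤ c

namespace IsPrincipalUnit

variable {c : ℝ} {f g : K⟦X⟧}

theorem norm_coeff_le_one (hf : IsPrincipalUnit c f) (hc : c < 1) (n : ℕ) : ‖coeff n f‖ ≤ 1 := by
  have h1 : coeff n f = coeff n (f - 1) + coeff n 1 := by rw [← map_add, sub_add_cancel]
  rw [h1]
  refine (IsUltrametricDist.norm_add_le_max _ _).trans (max_le ((hf.norm_le n).trans hc.le) ?_)
  rw [coeff_one]
  split_ifs <;> simp

theorem norm_constantCoeff (hf : IsPrincipalUnit c f) (hc : c < 1) : ‖constantCoeff f‖ = 1 := by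
  have h1 : constantCoeff f = coeff 0 (f - 1) + 1 := by simp
  have h2 : ‖coeff 0 (f - 1)‖ < ‖(1 : K)‖ := by
    rw [norm_one]
    exact (hf.norm_le 0).trans_lt hc
  rw [h1, IsUltrametricDist.norm_add_eq_max_of_norm_ne_norm h2.ne, max_eq_right h2.le, norm_one]

theorem mul (hf : IsPrincipalUnit c f) (hg : IsPrincipalUnit c g) (hc : c < 1) :
    IsPrincipalUnit c (f * g) := by
  refine ⟨mul_mem hf.mem hg.mem, fun n => ?_⟩
  have hc0 : 0 ≤ c := (norm_nonneg _).trans (hf.norm_le 0)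
  have h1 : f * g - 1 = (f - 1) * g + (g - 1) := by ring
  have h2 := norm_coeff_mul_mul_pow_le (r := 1) zero_le_one hc0 zero_le_one (f := f - 1) (g := g)
    (by simpa using hf.norm_le) (by simpa using hg.norm_coeff_le_one hc) n
  rw [one_pow, mul_one, mul_one] at h2
  rw [h1, map_add]
  exact (IsUltrametricDist.norm_add_le_max _ _).trans (max_le h2 (hg.norm_le n))

theorem inv [CompleteSpace K] (hf : IsPrincipalUnit c f) (hc : c < 1) : IsPrincipalUnit c f⁻¹ := by
  have hc0 : 0 ≤ c := (norm_nonneg _).trans (hf.norm_le 0)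
  have h0 : constantCoeff f ≠ 0 := norm_ne_zero_iff.1 (by simp [hf.norm_constantCoeff hc])
  have hone : ∀ n, ‖coeff n f⁻¹‖ ≤ 1 := fun n => by
    simpa using norm_coeff_inv_mul_pow_le_one zero_le_one (hf.norm_constantCoeff hc)
      (by simpa using hf.norm_coeff_le_one hc) n
  have hsub : ∀ n, ‖coeff n (1 - f)‖ ≤ c := fun n => by
    rw [← neg_sub, map_neg, norm_neg]
    exact hf.norm_le n
  have hpow : ∀ N n, ‖coeff n ((1 - f) ^ N * f⁻¹)‖ ≤ c ^ N := by
    intro N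
    induction N with
    | zero => simpa using hone
    | succ N ih =>
      intro n
      have := norm_coeff_mul_mul_pow_le (r := 1) zero_le_one hc0 (pow_nonneg hc0 N)
        (f := 1 - f) (g := (1 - f) ^ N * f⁻¹)
        (fun n => by rw [one_pow, mul_one]; exact hsub n)
        (fun n => by rw [one_pow, mul_one]; exact ih n) n
      rwa [one_pow, mul_one, ← mul_assoc, ← pow_succ', ← pow_succ'] at this
  refine ⟨?_, fun n => ?_⟩
  · rw [mem_restrictedSeries_iff_tendsto, NormedAddGroup.tendsto_nhds_zero]
    intro ε hε
    obtain ⟨N, hN⟩ := exists_pow_lt_of_lt_one hε hc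
    -- `f⁻¹` differs from a partial sum of the geometric series in `1 - f` by `(1 - f) ^ N * f⁻¹`
    have hgeom : f⁻¹ = ∑ i ∈ Finset.range N, (1 - f) ^ i + (1 - f) ^ N * f⁻¹ := by
      have h1 := geom_sum_mul_neg (1 - f) N
      rw [sub_sub_cancel] at h1
      have h2 := PowerSeries.mul_inv_cancel f h0
      linear_combination (∑ i ∈ Finset.range N, (1 - f) ^ i) * h2 - f⁻¹ * h1
    have hmem : ∑ i ∈ Finset.range N, (1 - f) ^ i ∈ restrictedSeries K :=
      sum_mem fun i _ => pow_mem (sub_mem (one_mem _) hf.mem) i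
    rw [mem_restrictedSeries_iff_tendsto, NormedAddGroup.tendsto_nhds_zero] at hmem
    filter_upwards [hmem ε hε] with n hn
    rw [hgeom, map_add]
    exact (IsUltrametricDist.norm_add_le_max _ _).trans_lt (max_lt hn ((hpow N n).trans_lt hN))
  · have h1 : f⁻¹ - 1 = (1 - f) ^ 1 * f⁻¹ := by
      linear_combination PowerSeries.mul_inv_cancel f h0
    rw [h1]
    simpa using hpow 1 n

theorem norm_evalOne_sub_one_le (hf : IsPrincipalUnit c f) : ‖evalOne K ⟨f, hf.mem⟩ - 1‖ ≤ c := by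
  have hc0 : 0 ≤ c := (norm_nonneg _).trans (hf.norm_le 0)
  rw [← map_one (evalOne K), ← map_sub]
  exact norm_evalOne_le hc0 hf.norm_le

theorem norm_evalOne (hf : IsPrincipalUnit c f) (hc : c < 1) : ‖evalOne K ⟨f, hf.mem⟩‖ = 1 := by
  have h1 := hf.norm_evalOne_sub_one_le
  have h2 : ‖evalOne K ⟨f, hf.mem⟩ - 1‖ < ‖(1 : K)‖ := by
    rw [norm_one]
    exact h1.trans_lt hc
  have h3 := IsUltrametricDist.norm_add_eq_max_of_norm_ne_norm h2.ne
  rwa [sub_add_cancel, max_eq_right h2.le, norm_one] at h3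

theorem evalOne_ne_zero (hf : IsPrincipalUnit c f) (hc : c < 1) : evalOne K ⟨f, hf.mem⟩ ≠ 0 :=
  norm_ne_zero_iff.1 ((hf.norm_evalOne hc).trans_ne one_ne_zero)

end IsPrincipalUnit

end Restricted

/-! ### The differential equations of the Weierstrass function -/

section Weierstrass

theorem coeff_X_mul_derivative {R : Type*} [CommRing R] (f : R⟦X⟧) (n : ℕ) :
    coeff n (X * d⁄dX R f) = n * coeff n f := by
  cases n with
  | zero => simp
  | succ n => rw [coeff_succ_X_mul, coeff_derivative, mul_comm]; push_cast; rfl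

variable {K : Type*} [NontriviallyNormedField K]

/-- The series `1 + ∑_{k ≥ 2} c_k T^k`, that is `z² ℘(z)` as a power series in `T = z²`. -/
def wpSeries (g₂ g₃ : K) : K⟦X⟧ := mk fun n => if n = 0 then 1 else wpCoeff g₂ g₃ n

theorem coeff_wpSeries_zero (g₂ g₃ : K) : coeff 0 (wpSeries g₂ g₃) = 1 := by simp [wpSeries]

theorem coeff_wpSeries_one (g₂ g₃ : K) : coeff 1 (wpSeries g₂ g₃) = 0 := by
  simp [wpSeries, wpCoeff]

theorem coeff_wpSeries_add_two (g₂ g₃ : K) (n : ℕ) :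
    coeff (n + 2) (wpSeries g₂ g₃) = wpCoeff g₂ g₃ (n + 2) := by simp [wpSeries]

variable [CharZero K]

/-- The recursion for the coefficients, as the equation `℘'' = 6 ℘² - g₂ / 2`: up to powers of `z`,
`℘'` is `-2 (P - T P')`. -/
theorem wpSeries_second_order (g₂ g₃ : K) {P G : K⟦X⟧} (hP : P = wpSeries g₂ g₃)
    (hG : G = P - X * d⁄dX K P) :
    3 * G - 2 * (X * d⁄dX K G) = 3 * P ^ 2 - C (g₂ / 4) * X ^ 2 := by
  have hGc : ∀ n, coeff n G = (1 - n) * coeff n P := fun n => by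
    rw [hG, map_sub, coeff_X_mul_derivative]
    ring
  ext n
  have hl : coeff n (3 * G - 2 * (X * d⁄dX K G)) = (3 - 2 * n) * (1 - n) * coeff n P := by
    have h3 : (3 : K⟦X⟧) = C (3 : K) := (map_ofNat C 3).symm
    have h2 : (2 : K⟦X⟧) = C (2 : K) := (map_ofNat C 2).symm
    rw [map_sub, h3, h2, coeff_C_mul, coeff_C_mul, coeff_X_mul_derivative, hGc]
    ring
  have hr : coeff n (3 * P ^ 2 - C (g₂ / 4) * X ^ 2)
      = 3 * (∑ p ∈ antidiagonal n, coeff p.1 P * coeff p.2 P)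
        - g₂ / 4 * if n = 2 then 1 else 0 := by
    have h3 : (3 : K⟦X⟧) = C (3 : K) := (map_ofNat C 3).symm
    rw [map_sub, h3, coeff_C_mul, coeff_C_mul, sq, coeff_mul, coeff_X_pow]
  rw [hl, hr, Finset.Nat.sum_antidiagonal_eq_sum_range_succ_mk]
  have h0 := coeff_wpSeries_zero g₂ g₃
  have h1 := coeff_wpSeries_one g₂ g₃
  rw [← hP] at h0 h1
  match n with
  | 0 => simp [h0]
  | 1 => simp [Finset.sum_range_succ, h1]
  | 2 =>
    have h2 := coeff_wpSeries_add_two g₂ g₃ 0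
    rw [← hP, wpCoeff] at h2
    simp only [Finset.sum_range_succ, h0, h1, h2]
    simp
    ring
  | 3 =>
    simp only [Finset.sum_range_succ, h0, h1]
    simp
    ring
  | m + 4 =>
    have hm := coeff_wpSeries_add_two g₂ g₃ (m + 2)
    have hmid : ∑ k ∈ Finset.range (m + 1), coeff (k + 1 + 1) P * coeff (m + 4 - (k + 1 + 1)) P
        = ∑ i : Fin (m + 1), wpCoeff g₂ g₃ (i + 2) * wpCoeff g₂ g₃ (m + 2 - i) := by
      rw [Fin.sum_univ_eq_sum_range fun i => wpCoeff g₂ g₃ (i + 2) * wpCoeff g₂ g₃ (m + 2 - i)]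
      refine Finset.sum_congr rfl fun i hi => ?_
      rw [Finset.mem_range] at hi
      obtain ⟨j, rfl⟩ : ∃ j, m = i + j := ⟨m - i, by omega⟩
      rw [hP, coeff_wpSeries_add_two, show i + j + 4 - (i + 1 + 1) = j + 2 by omega,
        coeff_wpSeries_add_two, show i + j + 2 - i = j + 2 by omega]
    rw [← hP, show m + 2 + 2 = m + 4 by omega, wpCoeff, ← hmid] at hm
    rw [Finset.sum_range_succ, Finset.sum_range_succ, Finset.sum_range_succ',
      Finset.sum_range_succ']
    rw [show m + 4 - (m + 4) = 0 by omega, show m + 1 + 1 + 1 = m + 3 by omega,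
      show m + 4 - (m + 3) = 1 by omega]
    generalize ∑ k ∈ Finset.range (m + 1), coeff (k + 1 + 1) P * coeff (m + 4 - (k + 1 + 1)) P = S
      at hm ⊢
    have ha : (2 * ((m : K) + 4) + 1) ≠ 0 := by
      exact_mod_cast (show 2 * (m + 4) + 1 ≠ 0 by omega)
    have hb : ((m : K) + 4) - 3 ≠ 0 := by
      rw [show (m : K) + 4 - 3 = m + 1 by ring]
      exact_mod_cast (show m + 1 ≠ 0 by omega)
    rw [eq_comm, div_mul_eq_mul_div, div_eq_iff (mul_ne_zero ha hb)] at hm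
    simp only [h0, h1, zero_add, Nat.sub_zero]
    push_cast
    linear_combination -hm

/-- The first integral `℘'² = 4 ℘³ - g₂ ℘ - g₃` of the second order equation. -/
theorem wpSeries_first_order (g₂ g₃ : K) {P G : K⟦X⟧} (hP : P = wpSeries g₂ g₃)
    (hG : G = P - X * d⁄dX K P) :
    G ^ 2 = P ^ 3 - C (g₂ / 4) * X ^ 2 * P - C (g₃ / 4) * X ^ 3 := by
  have h2 := wpSeries_second_order g₂ g₃ hP hG
  have hGc : ∀ n, coeff n G = (1 - n) * coeff n P := fun n => by
    rw [hG, map_sub, coeff_X_mul_derivative]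
    ring
  rw [← sub_eq_zero]
  set W := G ^ 2 - (P ^ 3 - C (g₂ / 4) * X ^ 2 * P - C (g₃ / 4) * X ^ 3) with hW
  have hEuler : X * d⁄dX K W = 3 * W := by
    have hd : d⁄dX K W = 2 * G * d⁄dX K G - (3 * P ^ 2 * d⁄dX K P
        - C (g₂ / 4) * (2 * X * P + X ^ 2 * d⁄dX K P) - C (g₃ / 4) * (3 * X ^ 2)) := by
      rw [hW]
      simp only [map_sub, Derivation.leibniz, Derivation.leibniz_pow, derivative_C, derivative_X,
        smul_eq_mul, nsmul_eq_mul]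
      push_cast
      ring
    rw [hd, hW]
    linear_combination -G * h2 + (-3 * P ^ 2 + C (g₂ / 4) * X ^ 2) * hG
  -- Euler's equation kills every coefficient of `W` but the third, the constant of integration,
  -- which vanishes by the value of the coefficient `g₃ / 28`.
  ext n
  have h3 : ((n : K) - 3) * coeff n W = 0 := by
    have := congrArg (coeff n) hEuler
    rw [coeff_X_mul_derivative, show (3 : K⟦X⟧) = C (3 : K) from (map_ofNat C 3).symm,
      coeff_C_mul] at this
    linear_combination this
  rcases mul_eq_zero.1 h3 with h | h
  · obtain rfl : n = 3 := by exact_mod_cast sub_eq_zero.1 h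
    have e0 := coeff_wpSeries_zero g₂ g₃
    have e1 := coeff_wpSeries_one g₂ g₃
    have e2 := coeff_wpSeries_add_two g₂ g₃ 0
    have e3 := coeff_wpSeries_add_two g₂ g₃ 1
    rw [← hP] at e0 e1 e2 e3
    rw [zero_add] at e2
    rw [show 1 + 2 = 3 by rfl, wpCoeff] at e3
    rw [hW, pow_succ P 2, sq G, sq P, mul_assoc (C (g₂ / 4)), map_sub, map_sub, map_sub,
      coeff_C_mul, coeff_C_mul, coeff_X_pow,
      show coeff 3 (X ^ 2 * P) = coeff 1 P from coeff_X_pow_mul P 2 1]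
    simp only [coeff_mul, Finset.Nat.sum_antidiagonal_eq_sum_range_succ_mk, Finset.sum_range_succ,
      Finset.sum_range_zero, hGc]
    simp [e0, e1, e3]
    ring
  · simpa using h

end Weierstrass

/-! ### The Edwards coordinates of the exponential map as formal power series -/

section Series

variable {K : Type*} [NontriviallyNormedField K]

/-- The power series `z² x(z)`, where `x = ℘ - a' / 3` is the first coordinate on the Weierstrass
curve `y² = x³ + a' x² + b' x`. -/
def xSeries (d x₁ : K) : K⟦X⟧ :=
  expand 2 two_ne_zero (wpSeries (g2 d x₁) (g3 d x₁) - C (aPrime d x₁ / 3) * X)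

/-- The power series `-z³ x'(z) / 2`, where `x = ℘ - a' / 3`. -/
def ySeries (d x₁ : K) : K⟦X⟧ :=
  expand 2 two_ne_zero (wpSeries (g2 d x₁) (g3 d x₁)
    - X * d⁄dX K (wpSeries (g2 d x₁) (g3 d x₁)))

/-- The first Edwards coordinate `κ x(z) / (-x'(z) / 2)` as a power series in `z`. -/
def uSeries (d x₁ κ : K) : K⟦X⟧ := C κ * X * (xSeries d x₁ * (ySeries d x₁)⁻¹)

/-- The second Edwards coordinate `(x(z) - x₁) / (x(z) + x₁)` as a power series in `z`. -/
def vSeries (d x₁ : K) : K⟦X⟧ :=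
  (xSeries d x₁ - C x₁ * X ^ 2) * (xSeries d x₁ + C x₁ * X ^ 2)⁻¹

variable {d x₁ κ : K}

theorem X_mul_derivative_expand_two {R : Type*} [CommRing R] (f : R⟦X⟧) :
    X * d⁄dX R (expand 2 two_ne_zero f) = 2 * expand 2 two_ne_zero (X * d⁄dX R f) := by
  ext n
  rw [coeff_X_mul_derivative, show (2 : R⟦X⟧) = C (2 : R) from (map_ofNat C 2).symm, coeff_C_mul,
    coeff_expand, coeff_expand]
  split_ifs with h
  · obtain ⟨m, rfl⟩ := h
    rw [Nat.mul_div_cancel_left m two_pos, coeff_X_mul_derivative]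
    push_cast
    ring
  · simp

theorem constantCoeff_xSeries : constantCoeff (xSeries d x₁) = 1 := by
  have := coeff_wpSeries_zero (g2 d x₁) (g3 d x₁)
  rw [coeff_zero_eq_constantCoeff_apply] at this
  rw [xSeries, constantCoeff_expand]
  simp [this]

theorem constantCoeff_ySeries : constantCoeff (ySeries d x₁) = 1 := by
  have := coeff_wpSeries_zero (g2 d x₁) (g3 d x₁)
  rw [coeff_zero_eq_constantCoeff_apply] at this
  rw [ySeries, constantCoeff_expand]
  simp [this]

theorem X_mul_derivative_xSeries :
    X * d⁄dX K (xSeries d x₁) = 2 * xSeries d x₁ - 2 * ySeries d x₁ := by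
  rw [xSeries, X_mul_derivative_expand_two, ySeries, ← mul_sub, ← map_sub]
  congr 2
  simp only [map_sub, Derivation.leibniz, derivative_C, derivative_X, smul_eq_mul]
  ring

theorem coeff_ySeries (n : ℕ) :
    2 * coeff n (ySeries d x₁) = (2 - n) * coeff n (xSeries d x₁) := by
  have := congrArg (coeff n) (X_mul_derivative_xSeries (d := d) (x₁ := x₁))
  rw [coeff_X_mul_derivative, show (2 : K⟦X⟧) = C (2 : K) from (map_ofNat C 2).symm, map_sub,
    coeff_C_mul, coeff_C_mul] at this
  linear_combination this

theorem coeff_xSeries_of_odd {n : ℕ} (hn : ¬ 2 ∣ n) : coeff n (xSeries d x₁) = 0 := by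
  rw [xSeries, coeff_expand, if_neg hn]

theorem coeff_ySeries_two_mul [CharZero K] (m : ℕ) :
    coeff (2 * m) (ySeries d x₁) = (1 - m) * coeff (2 * m) (xSeries d x₁) := by
  have h1 := coeff_ySeries (d := d) (x₁ := x₁) (2 * m)
  push_cast at h1
  exact mul_left_cancel₀ two_ne_zero (h1.trans (by ring))

theorem coeff_ySeries_of_odd {n : ℕ} (hn : ¬ 2 ∣ n) : coeff n (ySeries d x₁) = 0 := by
  rw [ySeries, coeff_expand, if_neg hn]

theorem coeff_xSeries_two_mul_add_four (n : ℕ) :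
    coeff (2 * n + 4) (xSeries d x₁) = wpCoeff (g2 d x₁) (g3 d x₁) (n + 2) := by
  rw [xSeries, show 2 * n + 4 = 2 * (n + 2) by ring, coeff_expand_mul, map_sub,
    coeff_wpSeries_add_two, coeff_C_mul, coeff_X, if_neg (by omega), mul_zero, sub_zero]

theorem coeff_xSeries_two : coeff 2 (xSeries d x₁) = -(aPrime d x₁ / 3) := by
  rw [xSeries, show coeff 2 = coeff (R := K) (2 * 1) from rfl, coeff_expand_mul, map_sub,
    coeff_wpSeries_one, coeff_C_mul, coeff_one_X, mul_one, zero_sub]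

theorem ySeries_mul_uSeries :
    ySeries d x₁ * uSeries d x₁ κ = C κ * X * xSeries d x₁ := by
  have h := PowerSeries.mul_inv_cancel (ySeries d x₁) (by simp [constantCoeff_ySeries])
  rw [uSeries]
  linear_combination C κ * X * xSeries d x₁ * h

theorem constantCoeff_xSeries_add : constantCoeff (xSeries d x₁ + C x₁ * X ^ 2) = 1 := by
  simp [constantCoeff_xSeries]

theorem mul_vSeries :
    (xSeries d x₁ + C x₁ * X ^ 2) * vSeries d x₁ = xSeries d x₁ - C x₁ * X ^ 2 := by
  have h := PowerSeries.mul_inv_cancel (xSeries d x₁ + C x₁ * X ^ 2)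
    (by simp [constantCoeff_xSeries_add])
  rw [vSeries]
  linear_combination (xSeries d x₁ - C x₁ * X ^ 2) * h

theorem ne_zero_of_constantCoeff_eq_one {f : K⟦X⟧} (h : constantCoeff f = 1) : f ≠ 0 := by
  rintro rfl
  simp at h

theorem C_kappa_sq (hκ : κ ^ 2 * (1 - d) = 4 * x₁) : C κ ^ 2 * (1 - C d) = 4 * C x₁ := by
  have := congrArg (C (R := K)) hκ
  simpa only [map_mul, map_pow, map_sub, map_one, map_ofNat] using this

theorem C_aPrime (hd : 1 - d ≠ 0) (hκ : κ ^ 2 * (1 - d) = 4 * x₁) :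
    C (aPrime d x₁) = 2 * C x₁ + C d * C κ ^ 2 := by
  have h1 : aPrime d x₁ = 2 * x₁ + d * κ ^ 2 := by
    rw [aPrime]
    field_simp
    linear_combination -d * hκ
  rw [h1]
  simp only [map_mul, map_pow, map_add, map_ofNat]

theorem constantCoeff_uSeries : constantCoeff (uSeries d x₁ κ) = 0 := by simp [uSeries]

theorem constantCoeff_vSeries : constantCoeff (vSeries d x₁) = 1 := by
  have := congrArg constantCoeff (mul_vSeries (d := d) (x₁ := x₁))
  simpa [constantCoeff_xSeries] using this

variable [CharZero K]

theorem X_mul_derivative_ySeries :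
    X * d⁄dX K (ySeries d x₁) = 3 * ySeries d x₁ - 3 * xSeries d x₁ ^ 2
      - 2 * C (aPrime d x₁) * X ^ 2 * xSeries d x₁ - C (bPrime x₁) * X ^ 4 := by
  rw [ySeries, X_mul_derivative_expand_two]
  have h := congrArg (expand 2 two_ne_zero) (wpSeries_second_order (g2 d x₁) (g3 d x₁) rfl rfl)
  simp only [map_sub, map_mul, map_pow, expand_C, expand_X, map_ofNat, xSeries] at h ⊢
  have h1 : C (g2 d x₁ / 4) = C (aPrime d x₁ / 3) ^ 2 * 3 - C (bPrime x₁) := by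
    rw [← map_ofNat C 3, ← map_pow, ← map_mul, ← map_sub, g2]
    congr 1
    field_simp
    ring
  have h2 : C (aPrime d x₁) = 3 * C (aPrime d x₁ / 3) := by
    rw [← map_ofNat C 3, ← map_mul]
    congr 1
    field_simp
  rw [h1] at h
  rw [h2]
  linear_combination -h

/-- The equation `y² = x³ + a' x² + b' x` for `y = x' / 2`. -/
theorem ySeries_sq :
    ySeries d x₁ ^ 2 = xSeries d x₁ ^ 3 + C (aPrime d x₁) * X ^ 2 * xSeries d x₁ ^ 2
      + C (bPrime x₁) * X ^ 4 * xSeries d x₁ := by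
  have h := congrArg (expand 2 two_ne_zero) (wpSeries_first_order (g2 d x₁) (g3 d x₁) rfl rfl)
  rw [map_pow, ← ySeries] at h
  rw [h]
  simp only [map_sub, map_mul, map_pow, expand_C, expand_X, xSeries]
  have h1 : C (g2 d x₁ / 4) = C (aPrime d x₁ / 3) ^ 2 * 3 - C (bPrime x₁) := by
    rw [← map_ofNat C 3, ← map_pow, ← map_mul, ← map_sub, g2]
    congr 1
    field_simp
    ring
  have h2 : C (aPrime d x₁) = 3 * C (aPrime d x₁ / 3) := by
    rw [← map_ofNat C 3, ← map_mul]
    congr 1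
    field_simp
  have h3 : C (g3 d x₁ / 4)
      = C (aPrime d x₁ / 3) * C (bPrime x₁) - 2 * C (aPrime d x₁ / 3) ^ 3 := by
    rw [← map_ofNat C 2, ← map_pow, ← map_mul, ← map_mul, ← map_sub, g3]
    congr 1
    field_simp
    ring
  rw [h1, h2, h3]
  ring

/-- The squares of the denominators of the Edwards coordinates:
`y² - d κ² x² = x (x + x₁)²`. -/
theorem ySeries_sq_sub (hd : 1 - d ≠ 0) (hκ : κ ^ 2 * (1 - d) = 4 * x₁) :
    ySeries d x₁ ^ 2 - C d * C κ ^ 2 * X ^ 2 * xSeries d x₁ ^ 2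
      = xSeries d x₁ * (xSeries d x₁ + C x₁ * X ^ 2) ^ 2 := by
  have hb : C (bPrime x₁) = C x₁ ^ 2 := by rw [bPrime, map_pow]
  rw [ySeries_sq, hb, C_aPrime hd hκ]
  ring

theorem curve_uSeries_vSeries (hd : 1 - d ≠ 0) (hκ : κ ^ 2 * (1 - d) = 4 * x₁) :
    uSeries d x₁ κ ^ 2 + vSeries d x₁ ^ 2 = 1 + C d * uSeries d x₁ κ ^ 2 * vSeries d x₁ ^ 2 := by
  have hU := ySeries_mul_uSeries (d := d) (x₁ := x₁) (κ := κ)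
  have hV := mul_vSeries (d := d) (x₁ := x₁)
  have hy := ySeries_sq_sub hd hκ
  have hk := C_kappa_sq hκ
  have hG := ne_zero_of_constantCoeff_eq_one (constantCoeff_ySeries (d := d) (x₁ := x₁))
  have hS := ne_zero_of_constantCoeff_eq_one (constantCoeff_xSeries_add (d := d) (x₁ := x₁))
  generalize uSeries d x₁ κ = U at *
  generalize vSeries d x₁ = V at *
  generalize xSeries d x₁ = F at *
  generalize ySeries d x₁ = G at *
  refine mul_left_cancel₀ (mul_ne_zero (pow_ne_zero 2 hG) (pow_ne_zero 2 hS)) ?_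
  have hU2 : G ^ 2 * U ^ 2 = (C κ * X * F) ^ 2 := by rw [← hU]; ring
  have hV2 : (F + C x₁ * X ^ 2) ^ 2 * V ^ 2 = (F - C x₁ * X ^ 2) ^ 2 := by rw [← hV]; ring
  linear_combination (F + C x₁ * X ^ 2) ^ 2 * hU2 + G ^ 2 * hV2
    - C d * ((F + C x₁ * X ^ 2) ^ 2 * V ^ 2 * hU2 + C κ ^ 2 * X ^ 2 * F ^ 2 * hV2)
    - 4 * F * C x₁ * X ^ 2 * hy + X ^ 2 * F ^ 2 * (F + C x₁ * X ^ 2) ^ 2 * hk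

/-- The invariant vector field in Edwards coordinates: `u' = κ v (1 - d u²)`. -/
theorem derivative_uSeries (hd : 1 - d ≠ 0) (hκ : κ ^ 2 * (1 - d) = 4 * x₁) :
    d⁄dX K (uSeries d x₁ κ) = C κ * vSeries d x₁ * (1 - C d * uSeries d x₁ κ ^ 2) := by
  have hU := ySeries_mul_uSeries (d := d) (x₁ := x₁) (κ := κ)
  have hV := mul_vSeries (d := d) (x₁ := x₁)
  have hy := ySeries_sq_sub hd hκ
  have hb : C (bPrime x₁) = C x₁ ^ 2 := by rw [bPrime, map_pow]
  have hG := ne_zero_of_constantCoeff_eq_one (constantCoeff_ySeries (d := d) (x₁ := x₁))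
  have hS := ne_zero_of_constantCoeff_eq_one (constantCoeff_xSeries_add (d := d) (x₁ := x₁))
  have hy0 := ySeries_sq (d := d) (x₁ := x₁)
  have hdF := X_mul_derivative_xSeries (d := d) (x₁ := x₁)
  have hdG := X_mul_derivative_ySeries (d := d) (x₁ := x₁)
  have hdU := congrArg (d⁄dX K) hU
  simp only [Derivation.leibniz, derivative_C, derivative_X, smul_eq_mul] at hdU
  rw [hb] at hdG hy0
  generalize uSeries d x₁ κ = U at *
  generalize vSeries d x₁ = V at *
  generalize xSeries d x₁ = F at *
  generalize ySeries d x₁ = G at *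
  have h1 : G ^ 2 * (X * d⁄dX K U) = C κ * X * (F * (F ^ 2 - C x₁ ^ 2 * X ^ 4)) := by
    linear_combination X * G * hdU - X * d⁄dX K G * hU + C κ * X * G * hdF - C κ * X * F * hdG
      - 2 * C κ * X * hy0
  refine mul_left_cancel₀ (mul_ne_zero (mul_ne_zero (pow_ne_zero 2 hG) hS) X_ne_zero) ?_
  have hU2 : G ^ 2 * U ^ 2 = (C κ * X * F) ^ 2 := by rw [← hU]; ring
  linear_combination (F + C x₁ * X ^ 2) * h1
    - C κ * X * (G ^ 2 - C d * G ^ 2 * U ^ 2) * hV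
    + C κ * X * (F - C x₁ * X ^ 2) * C d * hU2 - C κ * X * (F - C x₁ * X ^ 2) * hy

/-- The invariant vector field in Edwards coordinates: `v' = -κ u (1 - d v²)`. -/
theorem derivative_vSeries (hd : 1 - d ≠ 0) (hκ : κ ^ 2 * (1 - d) = 4 * x₁) :
    d⁄dX K (vSeries d x₁) = -C κ * uSeries d x₁ κ * (1 - C d * vSeries d x₁ ^ 2) := by
  have hU := ySeries_mul_uSeries (d := d) (x₁ := x₁) (κ := κ)
  have hV := mul_vSeries (d := d) (x₁ := x₁)
  have hy := ySeries_sq_sub hd hκ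
  have hk := C_kappa_sq hκ
  have hG := ne_zero_of_constantCoeff_eq_one (constantCoeff_ySeries (d := d) (x₁ := x₁))
  have hS := ne_zero_of_constantCoeff_eq_one (constantCoeff_xSeries_add (d := d) (x₁ := x₁))
  have hdF := X_mul_derivative_xSeries (d := d) (x₁ := x₁)
  have hdV := congrArg (d⁄dX K) hV
  simp only [Derivation.leibniz, Derivation.leibniz_pow, map_add, map_sub, derivative_C,
    derivative_X, smul_eq_mul, nsmul_eq_mul] at hdV
  push_cast at hdV
  generalize uSeries d x₁ κ = U at *
  generalize vSeries d x₁ = V at *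
  generalize xSeries d x₁ = F at *
  generalize ySeries d x₁ = G at *
  have hV2 : (F + C x₁ * X ^ 2) ^ 2 * V ^ 2 = (F - C x₁ * X ^ 2) ^ 2 := by rw [← hV]; ring
  have h1 : (F + C x₁ * X ^ 2) ^ 2 * (X * d⁄dX K V) = -4 * C x₁ * X ^ 2 * G := by
    linear_combination (F + C x₁ * X ^ 2) * X * hdV
      - (X * d⁄dX K F + 2 * C x₁ * X ^ 2) * hV + 2 * C x₁ * X ^ 2 * hdF
  refine mul_left_cancel₀ (mul_ne_zero (mul_ne_zero hG (pow_ne_zero 2 hS)) X_ne_zero) ?_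
  linear_combination G * h1 + C κ * X * (F + C x₁ * X ^ 2) ^ 2 * (1 - C d * V ^ 2) * hU
    - C d * C κ ^ 2 * X ^ 2 * F * hV2 - 4 * C x₁ * X ^ 2 * hy
    + X ^ 2 * F * (F + C x₁ * X ^ 2) ^ 2 * hk

/-- `z² x(z)` in terms of the Edwards coordinates: with `h = u / (κ z)`, one has
`4 z² x h² (1 - d v²) = (1 - d) (1 + v)²`. -/
theorem xSeries_eq_edwards (hd : 1 - d ≠ 0) :
    4 * xSeries d x₁ * (xSeries d x₁ * (ySeries d x₁)⁻¹) ^ 2 * (1 - C d * vSeries d x₁ ^ 2)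
      = (1 - C d) * (1 + vSeries d x₁) ^ 2 := by
  have hG := ne_zero_of_constantCoeff_eq_one (constantCoeff_ySeries (d := d) (x₁ := x₁))
  have hS := ne_zero_of_constantCoeff_eq_one (constantCoeff_xSeries_add (d := d) (x₁ := x₁))
  have hI := PowerSeries.mul_inv_cancel (ySeries d x₁) (by simp [constantCoeff_ySeries])
  have hV := mul_vSeries (d := d) (x₁ := x₁)
  have hy := ySeries_sq (d := d) (x₁ := x₁)
  have hb : C (bPrime x₁) = C x₁ ^ 2 := by rw [bPrime, map_pow]
  have ha : (1 - C d) * C (aPrime d x₁) = 2 * C x₁ * (1 + C d) := by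
    rw [← map_one C, ← map_sub, ← map_add, ← map_ofNat C 2, ← map_mul, ← map_mul, ← map_mul, aPrime]
    congr 1
    field_simp
  rw [hb] at hy
  have h1 : ySeries d x₁ * (xSeries d x₁ * (ySeries d x₁)⁻¹) = xSeries d x₁ := by
    linear_combination xSeries d x₁ * hI
  generalize xSeries d x₁ * (ySeries d x₁)⁻¹ = H at *
  generalize vSeries d x₁ = V at *
  generalize xSeries d x₁ = F at *
  generalize ySeries d x₁ = G at *
  have h2 : G ^ 2 * H ^ 2 = F ^ 2 := by rw [← h1]; ring
  have h3 : (F + C x₁ * X ^ 2) ^ 2 * V ^ 2 = (F - C x₁ * X ^ 2) ^ 2 := by rw [← hV]; ring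
  have h4 : (F + C x₁ * X ^ 2) ^ 2 * (1 + V) ^ 2 = (2 * F) ^ 2 := by
    rw [show 2 * F = (F + C x₁ * X ^ 2) * (1 + V) by linear_combination -hV]
    ring
  refine mul_left_cancel₀ (mul_ne_zero (pow_ne_zero 2 hG) (pow_ne_zero 2 hS)) ?_
  linear_combination 4 * F * (F + C x₁ * X ^ 2) ^ 2 * (1 - C d * V ^ 2) * h2
    - 4 * F ^ 3 * C d * h3 - (1 - C d) * G ^ 2 * h4 - 4 * F ^ 2 * (1 - C d) * hy
    - 4 * F ^ 4 * X ^ 2 * ha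

end Series

/-! ### The addition theorem -/

section Addition

/-- Infinitesimal translation invariance: differentiating the first coordinate of a sum along the
vector field `(b (1 - d a²), -a (1 - d b²))` in the first summand `(a, b)` gives the vector field
at the sum, with denominators cleared. -/
theorem addition_flow_x {R : Type*} [CommRing R] {d a b p q : R}
    (h1 : a ^ 2 + b ^ 2 = 1 + d * a ^ 2 * b ^ 2) (h2 : p ^ 2 + q ^ 2 = 1 + d * p ^ 2 * q ^ 2) :
    ((b * q * (1 - d * a ^ 2) - p * a * (1 - d * b ^ 2)) * (1 + d * a * p * b * q)
      - (a * q + p * b) * (d * p * q * (b ^ 2 - a ^ 2))) * (1 - d * a * p * b * q)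
    = (b * q - a * p) * ((1 + d * a * p * b * q) ^ 2 - d * (a * q + p * b) ^ 2) := by
  grind

/-- The analogue of `addition_flow_x` for the second coordinate of the sum. -/
theorem addition_flow_y {R : Type*} [CommRing R] {d a b p q : R}
    (h1 : a ^ 2 + b ^ 2 = 1 + d * a ^ 2 * b ^ 2) (h2 : p ^ 2 + q ^ 2 = 1 + d * p ^ 2 * q ^ 2) :
    ((-(a * q * (1 - d * b ^ 2)) - p * b * (1 - d * a ^ 2)) * (1 - d * a * p * b * q)
      + (b * q - a * p) * (d * p * q * (b ^ 2 - a ^ 2))) * (1 + d * a * p * b * q)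
    = -(a * q + p * b) * ((1 - d * a * p * b * q) ^ 2 - d * (b * q - a * p) ^ 2) := by
  grind

/-- The derivative of a quotient `n / m`, with the denominators cleared in the hypothesis. -/
theorem quotient_rule_aux {R : Type*} [CommRing R] {n m i n' m' j dn dm c d : R} (hm : m * i = 1)
    (hm' : m' * j = 1) (h : (dn * m - n * dm) * m' = c * n' * (m ^ 2 - d * n ^ 2)) :
    n * (-i ^ 2 * dm) + i * dn = c * (n' * j) * (1 - d * (n * i) ^ 2) := by
  linear_combination i ^ 2 * j * h - i ^ 2 * m * dn * hm' - i * dn * hm + i ^ 2 * n * dm * hm'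
    + c * n' * j * (i * m + 1) * hm

variable {K : Type*} [NontriviallyNormedField K]

/-- `t ↦ (u, v)` is an integral curve, of speed `γ`, of the invariant vector field
`v (1 - d u²) ∂u - u (1 - d v²) ∂v` of the Edwards curve. -/
structure IsIntegralCurve (d γ : K) (u v : K⟦X⟧) : Prop where
  deriv_u : d⁄dX K u = C γ * v * (1 - C d * u ^ 2)
  deriv_v : d⁄dX K v = -C γ * u * (1 - C d * v ^ 2)

theorem derivative_rescale {R : Type*} [CommRing R] (a : R) (f : R⟦X⟧) :
    d⁄dX R (rescale a f) = C a * rescale a (d⁄dX R f) := by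
  ext n
  rw [coeff_derivative, coeff_rescale, coeff_C_mul, coeff_rescale, coeff_derivative]
  ring

theorem rescale_C {R : Type*} [CommRing R] (a b : R) : rescale a (C b) = C b := by
  ext n
  rw [coeff_rescale, coeff_C]
  split_ifs with h <;> simp [h]

theorem constantCoeff_rescale {R : Type*} [CommRing R] (a : R) (f : R⟦X⟧) :
    constantCoeff (rescale a f) = constantCoeff f := by
  rw [← coeff_zero_eq_constantCoeff_apply, coeff_rescale]
  simp

theorem IsIntegralCurve.rescale {d γ : K} {u v : K⟦X⟧} (h : IsIntegralCurve d γ u v) (a : K) :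
    IsIntegralCurve d (a * γ) (PowerSeries.rescale a u) (PowerSeries.rescale a v) := by
  constructor
  · rw [derivative_rescale, h.deriv_u]
    simp only [map_mul, map_sub, map_one, map_pow, rescale_C]
    ring
  · rw [derivative_rescale, h.deriv_v]
    simp only [map_mul, map_sub, map_one, map_pow, map_neg, rescale_C]
    ring

theorem rescale_uSeries {d x₁ κ : K} (z : K) : rescale z (uSeries d x₁ κ)
    = C (κ * z) * X * rescale z (xSeries d x₁ * (ySeries d x₁)⁻¹) := by
  rw [uSeries, map_mul, map_mul, rescale_C, rescale_X, map_mul C]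
  ring

variable [CharZero K]

/-- An integral curve is determined by its initial point. -/
theorem IsIntegralCurve.unique {d γ : K} {u v u' v' : K⟦X⟧} (h : IsIntegralCurve d γ u v)
    (h' : IsIntegralCurve d γ u' v') (hu : constantCoeff u = constantCoeff u')
    (hv : constantCoeff v = constantCoeff v') : u = u' ∧ v = v' := by
  have hstep : ∀ (n : ℕ) (f g : K⟦X⟧), constantCoeff f = constantCoeff g →
      X ^ n ∣ d⁄dX K f - d⁄dX K g → X ^ (n + 1) ∣ f - g := by
    intro n f g h0 hd
    rw [X_pow_dvd_iff] at hd ⊢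
    intro m hm
    cases m with
    | zero => simp [h0]
    | succ m =>
      have := hd m (by omega)
      rw [← map_sub, coeff_derivative] at this
      exact (mul_eq_zero.1 this).resolve_right (by exact_mod_cast m.succ_ne_zero)
  have key : ∀ n : ℕ, X ^ n ∣ u - u' ∧ X ^ n ∣ v - v' := by
    intro n
    induction n with
    | zero => simp
    | succ n ih =>
      refine ⟨hstep n u u' hu ?_, hstep n v v' hv ?_⟩
      · rw [h.deriv_u, h'.deriv_u]
        have e : C γ * v * (1 - C d * u ^ 2) - C γ * v' * (1 - C d * u' ^ 2)
          = (v - v') * (C γ * (1 - C d * u ^ 2)) - (u - u') * (C γ * C d * v' * (u + u')) := by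
          ring
        rw [e]
        exact dvd_sub (ih.2.mul_right _) (ih.1.mul_right _)
      · rw [h.deriv_v, h'.deriv_v]
        have e : -C γ * u * (1 - C d * v ^ 2) - -C γ * u' * (1 - C d * v' ^ 2)
          = (v - v') * (C γ * C d * u' * (v + v')) - (u - u') * (C γ * (1 - C d * v ^ 2)) := by
          ring
        rw [e]
        exact dvd_sub (ih.2.mul_right _) (ih.1.mul_right _)
  have hz : ∀ f : K⟦X⟧, (∀ n : ℕ, X ^ n ∣ f) → f = 0 := fun f hf => by
    ext n
    simpa using X_pow_dvd_iff.1 (hf (n + 1)) n n.lt_succ_self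
  exact ⟨sub_eq_zero.1 (hz _ fun n => (key n).1), sub_eq_zero.1 (hz _ fun n => (key n).2)⟩

/-- The pointwise sum of two integral curves through the neutral element is an integral curve, and
the speeds add: the vector field is invariant under translations. -/
theorem IsIntegralCurve.add {d α β : K} {a b p q : K⟦X⟧} (h : IsIntegralCurve d α a b)
    (h' : IsIntegralCurve d β p q) (h1 : a ^ 2 + b ^ 2 = 1 + C d * a ^ 2 * b ^ 2)
    (h2 : p ^ 2 + q ^ 2 = 1 + C d * p ^ 2 * q ^ 2) (ha : constantCoeff a = 0) :
    IsIntegralCurve d (α + β) ((a * q + p * b) * (1 + C d * a * p * b * q)⁻¹)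
      ((b * q - a * p) * (1 - C d * a * p * b * q)⁻¹) := by
  have hM := PowerSeries.mul_inv_cancel (1 + C d * a * p * b * q) (by simp [ha])
  have hM' := PowerSeries.mul_inv_cancel (1 - C d * a * p * b * q) (by simp [ha])
  have e1 := addition_flow_x h1 h2
  have e2 := addition_flow_x h2 h1
  have f1 := addition_flow_y h1 h2
  have f2 := addition_flow_y h2 h1
  constructor
  · rw [Derivation.leibniz, derivative_inv', smul_eq_mul, smul_eq_mul]
    refine quotient_rule_aux hM hM' ?_
    simp only [map_add, Derivation.leibniz, derivative_one, derivative_C, smul_eq_mul,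
      h.deriv_u, h.deriv_v, h'.deriv_u, h'.deriv_v]
    linear_combination C α * e1 + C β * e2
  · rw [Derivation.leibniz, derivative_inv', smul_eq_mul, smul_eq_mul, ← map_neg]
    refine quotient_rule_aux hM' hM ?_
    simp only [map_add, map_sub, map_neg, Derivation.leibniz, derivative_one, derivative_C,
      smul_eq_mul, h.deriv_u, h.deriv_v, h'.deriv_u, h'.deriv_v]
    linear_combination C α * f1 + C β * f2

variable {d x₁ κ : K}

theorem isIntegralCurve_uSeries_vSeries (hd : 1 - d ≠ 0) (hκ : κ ^ 2 * (1 - d) = 4 * x₁) :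
    IsIntegralCurve d κ (uSeries d x₁ κ) (vSeries d x₁) :=
  ⟨derivative_uSeries hd hκ, derivative_vSeries hd hκ⟩

theorem rescale_curve (hd : 1 - d ≠ 0) (hκ : κ ^ 2 * (1 - d) = 4 * x₁) (z : K) :
    rescale z (uSeries d x₁ κ) ^ 2 + rescale z (vSeries d x₁) ^ 2
      = 1 + C d * rescale z (uSeries d x₁ κ) ^ 2 * rescale z (vSeries d x₁) ^ 2 := by
  have := congrArg (rescale z) (curve_uSeries_vSeries hd hκ)
  simpa only [map_add, map_mul, map_pow, map_one, rescale_C] using this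

/-- The addition theorem along the line `t ↦ (t z, t w)`, as an identity of power series in `t`:
both sides are integral curves through the neutral element with the same speed. -/
theorem rescale_add_uSeries_vSeries (hd : 1 - d ≠ 0) (hκ : κ ^ 2 * (1 - d) = 4 * x₁) (z w : K)
    {a b p q : K⟦X⟧} (ha : a = rescale z (uSeries d x₁ κ)) (hb : b = rescale z (vSeries d x₁))
    (hp : p = rescale w (uSeries d x₁ κ)) (hq : q = rescale w (vSeries d x₁)) :
    rescale (z + w) (uSeries d x₁ κ) * (1 + C d * a * p * b * q) = a * q + p * b ∧
      rescale (z + w) (vSeries d x₁) * (1 - C d * a * p * b * q) = b * q - a * p := by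
  have hcurve := isIntegralCurve_uSeries_vSeries hd hκ
  have hz := hcurve.rescale z
  have hw := hcurve.rescale w
  have hz0 := rescale_curve hd hκ z
  have hw0 := rescale_curve hd hκ w
  have ha0 : constantCoeff a = 0 := by rw [ha, constantCoeff_rescale, constantCoeff_uSeries]
  have hp0 : constantCoeff p = 0 := by rw [hp, constantCoeff_rescale, constantCoeff_uSeries]
  have hb0 : constantCoeff b = 1 := by rw [hb, constantCoeff_rescale, constantCoeff_vSeries]
  have hq0 : constantCoeff q = 1 := by rw [hq, constantCoeff_rescale, constantCoeff_vSeries]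
  rw [← ha, ← hb] at hz hz0
  rw [← hp, ← hq] at hw hw0
  have hsum := hz.add hw hz0 hw0 ha0
  rw [← add_mul] at hsum
  have hM := PowerSeries.inv_mul_cancel (1 + C d * a * p * b * q) (by simp [ha0])
  have hM' := PowerSeries.inv_mul_cancel (1 - C d * a * p * b * q) (by simp [ha0])
  obtain ⟨hu, hv⟩ := (hcurve.rescale (z + w)).unique hsum
    (by simp [constantCoeff_rescale, constantCoeff_uSeries, ha0, hp0])
    (by simp [constantCoeff_rescale, constantCoeff_vSeries, ha0, hb0, hq0])
  rw [hu, hv]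
  constructor
  · linear_combination (a * q + p * b) * hM
  · linear_combination (b * q - a * p) * hM'

end Addition

/-! ### Convergence for small ramification -/

section Convergence

variable {K : Type*} [NontriviallyNormedField K]

theorem norm_eq_one_of_sq_mul_eq {d x₁ κ : K} (h2 : ‖(2 : K)‖ = 1) (hd1 : ‖1 - d‖ = 1)
    (hx : ‖x₁‖ = 1) (hκ : κ ^ 2 * (1 - d) = 4 * x₁) : ‖κ‖ = 1 := by
  have h1 := congrArg norm hκ
  rw [norm_mul, norm_pow, hd1, mul_one, norm_mul, hx, show (4 : K) = 2 * 2 by norm_num, norm_mul,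
    h2, one_mul, one_mul] at h1
  exact (pow_eq_one_iff_of_nonneg (norm_nonneg κ) two_ne_zero).1 h1

variable [IsUltrametricDist K]

theorem norm_natCast_eq_one_of_res_ne_zero {n : ℕ} (h : (n : resField K) ≠ 0) : ‖(n : K)‖ = 1 := by
  have := norm_eq_one_of_res_ne_zero (K := K) (x := (n : ringOfIntegers K)) (by rwa [map_natCast])
  exact_mod_cast this

/-- The power series of Gauss norm at most `1` on the disc of radius `r`. -/
def gaussUnitBall (K : Type*) [NontriviallyNormedField K] [IsUltrametricDist K] (r : ℝ)
    (hr : 0 ≤ r) : Subring K⟦X⟧ where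
  carrier := {f | ∀ n, ‖coeff n f‖ * r ^ n ≤ 1}
  mul_mem' hf hg n := by
    simpa using norm_coeff_mul_mul_pow_le hr zero_le_one zero_le_one hf hg n
  one_mem' n := by
    rw [coeff_one]
    split_ifs with h <;> simp [h]
  add_mem' hf hg := norm_coeff_add_mul_pow_le hr hf hg
  zero_mem' n := by simp
  neg_mem' hf n := by simpa using hf n

theorem C_mem_gaussUnitBall {r : ℝ} (hr : 0 ≤ r) {a : K} (ha : ‖a‖ ≤ 1) :
    C a ∈ gaussUnitBall K r hr := fun n => by
  rw [coeff_C]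
  split_ifs with h <;> simp [h, ha]

/-- The power series `f` for which the derivatives `f⁽ⁿ⁾(0) = n! f_n` with `n ≤ N` are integral. -/
def dividedPowerSubring (K : Type*) [NontriviallyNormedField K] [IsUltrametricDist K] (N : ℕ) :
    Subring K⟦X⟧ where
  carrier := {f | ∀ n ≤ N, ‖(n.factorial : K) * coeff n f‖ ≤ 1}
  mul_mem' {f g} hf hg n hn := by
    rw [coeff_mul, Finset.mul_sum]
    refine IsUltrametricDist.norm_sum_le_of_forall_le_of_nonneg zero_le_one fun p hp => ?_
    rw [mem_antidiagonal] at hp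
    have h1 : ((n.factorial : ℕ) : K) * (coeff p.1 f * coeff p.2 g)
        = ((p.1 + p.2).choose p.2 : K)
          * ((p.1.factorial * coeff p.1 f) * (p.2.factorial * coeff p.2 g)) := by
      rw [← hp, ← Nat.add_choose_mul_factorial_mul_factorial]
      push_cast
      ring
    rw [h1, norm_mul, norm_mul]
    exact mul_le_one₀ (IsUltrametricDist.norm_natCast_le_one K _) (by positivity)
      (mul_le_one₀ (hf _ (by omega)) (norm_nonneg _) (hg _ (by omega)))
  one_mem' n _ := by
    rw [coeff_one]
    split_ifs with h <;> simp [h]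
  add_mem' {f g} hf hg n hn := by
    rw [map_add, mul_add]
    exact (IsUltrametricDist.norm_add_le_max _ _).trans (max_le (hf n hn) (hg n hn))
  zero_mem' n _ := by simp
  neg_mem' hf n hn := by simpa using hf n hn

theorem C_mem_dividedPowerSubring {N : ℕ} {a : K} (ha : ‖a‖ ≤ 1) :
    C a ∈ dividedPowerSubring K N := fun n _ => by
  rw [coeff_C]
  split_ifs with h <;> simp [h, ha]

theorem mem_dividedPowerSubring_succ {N : ℕ} {f : K⟦X⟧} (h0 : ‖constantCoeff f‖ ≤ 1)
    (h : d⁄dX K f ∈ dividedPowerSubring K N) : f ∈ dividedPowerSubring K (N + 1) := by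
  intro n hn
  cases n with
  | zero => simpa using h0
  | succ n =>
    have := h n (by omega)
    rw [coeff_derivative] at this
    convert this using 2
    rw [Nat.factorial_succ]
    push_cast
    ring

/-- An integral curve with integral data has integral derivatives at the origin, because the
coefficients of the vector field are polynomials. -/
theorem IsIntegralCurve.mem_dividedPowerSubring {d γ : K} {u v : K⟦X⟧}
    (h : IsIntegralCurve d γ u v) (hd : ‖d‖ ≤ 1) (hγ : ‖γ‖ ≤ 1) (hu : ‖constantCoeff u‖ ≤ 1)
    (hv : ‖constantCoeff v‖ ≤ 1) (N : ℕ) :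
    u ∈ dividedPowerSubring K N ∧ v ∈ dividedPowerSubring K N := by
  induction N with
  | zero =>
    refine ⟨fun n hn => ?_, fun n hn => ?_⟩
    · obtain rfl : n = 0 := by omega
      simpa using hu
    · obtain rfl : n = 0 := by omega
      simpa using hv
  | succ N ih =>
    have hD : C d ∈ dividedPowerSubring K N := C_mem_dividedPowerSubring hd
    have hG : C γ ∈ dividedPowerSubring K N := C_mem_dividedPowerSubring hγ
    refine ⟨mem_dividedPowerSubring_succ hu ?_, mem_dividedPowerSubring_succ hv ?_⟩
    · rw [h.deriv_u]
      exact mul_mem (mul_mem hG ih.2) (sub_mem (one_mem _) (mul_mem hD (pow_mem ih.1 2)))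
    · rw [h.deriv_v]
      exact mul_mem (mul_mem (neg_mem hG) ih.1) (sub_mem (one_mem _) (mul_mem hD (pow_mem ih.2 2)))

theorem wpConvergesAt_of_mem_gaussUnitBall [CompleteSpace K] {d x₁ z : K} {r : ℝ} (hr0 : 0 ≤ r)
    (hF : xSeries d x₁ ∈ gaussUnitBall K r hr0) (hzr : ‖z‖ < r) (hz1 : ‖z‖ ≤ 1) :
    WpConvergesAt (g2 d x₁) (g3 d x₁) z := by
  have hr : 0 < r := (norm_nonneg z).trans_lt hzr
  have hlim : Tendsto (fun j : ℕ => (‖z‖ / r) ^ (2 * j + 4) * (‖z‖ ^ 3)⁻¹) cofinite (𝓝 0) := by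
    rw [Nat.cofinite_eq_atTop, ← zero_mul (‖z‖ ^ 3)⁻¹]
    refine Tendsto.mul_const _ ((tendsto_pow_atTop_nhds_zero_of_lt_one (by positivity)
      ((div_lt_one hr).2 hzr)).comp (tendsto_atTop_mono (fun j => ?_) tendsto_id))
    simp only [id]
    omega
  have hbound : ∀ j : ℕ, ‖wpCoeff (g2 d x₁) (g3 d x₁) (j + 2)‖ * ‖z‖ ^ (2 * j + 1)
      ≤ (‖z‖ / r) ^ (2 * j + 4) * (‖z‖ ^ 3)⁻¹ := fun j => by
    obtain hz | hz := (norm_nonneg z).eq_or_lt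
    · rw [← hz]
      simp
    have := hF (2 * j + 4)
    rw [coeff_xSeries_two_mul_add_four, ← le_div_iff₀ (by positivity)] at this
    refine (mul_le_mul_of_nonneg_right this (by positivity)).trans_eq ?_
    rw [div_pow]
    field_simp
    ring
  constructor
  · refine NonarchimedeanAddGroup.summable_of_tendsto_cofinite_zero
      (squeeze_zero_norm (fun j => le_trans ?_ (hbound j)) hlim)
    rw [wpTerm, norm_mul, norm_pow]
    exact mul_le_mul_of_nonneg_left (pow_le_pow_of_le_one (norm_nonneg z) hz1 (by omega))
      (norm_nonneg _)
  · refine NonarchimedeanAddGroup.summable_of_tendsto_cofinite_zero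
      (squeeze_zero_norm (fun j => le_trans ?_ (hbound j)) hlim)
    rw [wpDerivTerm, norm_mul, norm_mul, norm_pow]
    refine mul_le_mul_of_nonneg_right (mul_le_of_le_one_left (norm_nonneg _) ?_) (by positivity)
    have := IsUltrametricDist.norm_natCast_le_one K (2 * j + 2)
    exact_mod_cast this

variable [CharZero K]

/-- If `r` is at most the radius of convergence of the exponential series, in the sense that
`r ^ n ≤ ‖(n + 1)!‖`, then `z² x(z)` has Gauss norm at most `1` on the disc of radius `r`. -/
theorem xSeries_mem_gaussUnitBall {d x₁ κ : K} (hd : ‖d‖ ≤ 1) (hd1 : ‖1 - d‖ = 1)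
    (h2 : ‖(2 : K)‖ = 1) (hκ1 : ‖κ‖ = 1) (hκ : κ ^ 2 * (1 - d) = 4 * x₁) {r : ℝ} (hr0 : 0 ≤ r)
    (hr1 : r ≤ 1) (hr : ∀ n : ℕ, r ^ n ≤ ‖((n + 1).factorial : K)‖) :
    xSeries d x₁ ∈ gaussUnitBall K r hr0 := by
  have hd0 : 1 - d ≠ 0 := norm_ne_zero_iff.1 (by simp [hd1])
  have hcurve := isIntegralCurve_uSeries_vSeries hd0 hκ
  have hdp := hcurve.mem_dividedPowerSubring hd hκ1.le (by simp [constantCoeff_uSeries])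
    (by simp [constantCoeff_vSeries])
  have hV : vSeries d x₁ ∈ gaussUnitBall K r hr0 := fun n => by
    refine le_trans ?_ ((hdp n).2 n le_rfl)
    rw [norm_mul, mul_comm]
    refine mul_le_mul_of_nonneg_right ?_ (norm_nonneg _)
    cases n with
    | zero => simp
    | succ n =>
      exact (pow_le_pow_of_le_one hr0 hr1 n.le_succ).trans (hr n)
  set H := xSeries d x₁ * (ySeries d x₁)⁻¹ with hHdef
  have hH : H ∈ gaussUnitBall K r hr0 := fun n => by
    have h1 := (hdp (n + 1)).1 (n + 1) le_rfl
    rw [uSeries, ← hHdef, mul_assoc, coeff_C_mul, coeff_succ_X_mul, norm_mul, norm_mul, hκ1,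
      one_mul] at h1
    refine le_trans ?_ h1
    rw [mul_comm]
    exact mul_le_mul_of_nonneg_right (hr n) (norm_nonneg _)
  have hH0 : constantCoeff H = 1 := by
    simp [hHdef, constantCoeff_xSeries, constantCoeff_ySeries]
  have hHinv : H⁻¹ ∈ gaussUnitBall K r hr0 := norm_coeff_inv_mul_pow_le_one hr0 (by simp [hH0]) hH
  have hW : 1 - C d * vSeries d x₁ ^ 2 ∈ gaussUnitBall K r hr0 :=
    sub_mem (one_mem _) (mul_mem (C_mem_gaussUnitBall hr0 hd) (pow_mem hV 2))
  have hW0 : constantCoeff (1 - C d * vSeries d x₁ ^ 2) = 1 - d := by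
    simp [constantCoeff_vSeries]
  have hWinv : (1 - C d * vSeries d x₁ ^ 2)⁻¹ ∈ gaussUnitBall K r hr0 :=
    norm_coeff_inv_mul_pow_le_one hr0 (by rw [hW0, hd1]) hW
  have h4 : ‖(1 - d) / 4‖ ≤ 1 := by
    rw [norm_div, hd1, show (4 : K) = 2 * 2 by norm_num, norm_mul, h2]
    norm_num
  have key : xSeries d x₁ = C ((1 - d) / 4) * (1 + vSeries d x₁) ^ 2 * H⁻¹ ^ 2
      * (1 - C d * vSeries d x₁ ^ 2)⁻¹ := by
    have e1 := PowerSeries.mul_inv_cancel H (by simp [hH0])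
    have e2 := PowerSeries.mul_inv_cancel (1 - C d * vSeries d x₁ ^ 2) (by rwa [hW0])
    have e3 := xSeries_eq_edwards (x₁ := x₁) hd0
    rw [← hHdef] at e3
    have e4 : C ((1 - d) / 4) * 4 = 1 - C d := by
      rw [← map_one C, ← map_sub, ← map_ofNat C 4, ← map_mul]
      congr 1
      field_simp
    have h40 : (4 : K⟦X⟧) ≠ 0 := by
      rw [← map_ofNat C 4, Ne, map_eq_zero_iff _ C_injective]
      norm_num
    refine mul_left_cancel₀ h40 ?_
    generalize (1 - C d * vSeries d x₁ ^ 2)⁻¹ = J at *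
    generalize 1 - C d * vSeries d x₁ ^ 2 = W at *
    linear_combination H⁻¹ ^ 2 * J * e3 - (1 + vSeries d x₁) ^ 2 * H⁻¹ ^ 2 * J * e4
      - 4 * xSeries d x₁ * H ^ 2 * H⁻¹ ^ 2 * e2 - 4 * xSeries d x₁ * (H * H⁻¹ + 1) * e1
  rw [key]
  exact mul_mem (mul_mem (mul_mem (C_mem_gaussUnitBall hr0 h4)
    (pow_mem (add_mem (one_mem _) hV) 2)) (pow_mem hHinv 2)) hWinv

/-- For ramification index less than `p - 1` the maximal ideal lies in the disc of convergence of
the exponential series, whose radius is `‖p‖ ^ (1 / (p - 1))` by Legendre's formula. -/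
theorem exists_radius (h : ∀ p : ℕ, p.Prime → CharP (resField K) p →
      ∀ z : maxIdeal K, ‖(z.1 : K)‖ ^ (p - 1) < ‖(p : K)‖) (z : maxIdeal K) :
    ∃ r : ℝ, ‖(z.1 : K)‖ < r ∧ r ≤ 1 ∧ ∀ n : ℕ, r ^ n ≤ ‖((n + 1).factorial : K)‖ := by
  obtain ⟨p, hp⟩ := CharP.exists (resField K)
  rcases CharP.char_is_prime_or_zero (resField K) p with hprime | rfl
  · have := Fact.mk hprime
    have hp1 : p - 1 ≠ 0 := by have := hprime.two_le; omega
    have hpK : 0 < ‖(p : K)‖ := norm_pos_iff.2 (by exact_mod_cast hprime.ne_zero)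
    set r : ℝ := ‖(p : K)‖ ^ ((p - 1 : ℕ) : ℝ)⁻¹ with hr
    have hr0 : 0 ≤ r := by positivity
    have hrp : r ^ (p - 1) = ‖(p : K)‖ := Real.rpow_inv_natCast_pow hpK.le hp1
    have hr1 : r ≤ 1 := Real.rpow_le_one hpK.le (IsUltrametricDist.norm_natCast_le_one K p)
      (by positivity)
    refine ⟨r, lt_of_pow_lt_pow_left₀ (p - 1) hr0 (by rw [hrp]; exact h p hprime hp z), hr1,
      fun n => ?_⟩
    obtain ⟨m, hm⟩ := pow_padicValNat_dvd (p := p) (n := (n + 1).factorial)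
    have hfac : (n + 1).factorial ≠ 0 := Nat.factorial_ne_zero _
    have hpm : ¬ p ∣ m := fun hdvd => by
      refine pow_succ_padicValNat_not_dvd (p := p) hfac ?_
      obtain ⟨k, rfl⟩ := hdvd
      exact ⟨k, by rw [pow_succ, mul_assoc]; exact hm⟩
    have hm1 : ‖(m : K)‖ = 1 := norm_natCast_eq_one_of_res_ne_zero
      (by rwa [Ne, CharP.cast_eq_zero_iff (resField K) p])
    have hlt := sub_one_mul_padicValNat_factorial_lt_of_ne_zero p (n := n + 1) n.succ_ne_zero
    have hn : ‖((n + 1).factorial : K)‖ = r ^ ((p - 1) * padicValNat p (n + 1).factorial) := by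
      rw [pow_mul, hrp]
      conv_lhs => rw [hm]
      rw [Nat.cast_mul, Nat.cast_pow, norm_mul, norm_pow, hm1, mul_one]
    rw [hn]
    exact pow_le_pow_of_le_one hr0 hr1 (by omega)
  · have : CharZero (resField K) := CharP.charP_to_charZero _
    refine ⟨1, norm_lt_one_of_res_eq_zero ((IsLocalRing.residue_eq_zero_iff _).2 z.2), le_rfl,
      fun n => ?_⟩
    rw [one_pow, norm_natCast_eq_one_of_res_ne_zero]
    exact_mod_cast Nat.factorial_ne_zero _

end Convergence

/-! ### The exponential map on the disc of convergence -/

section ExpMap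

variable {K : Type*} [NontriviallyNormedField K]

/-- An Edwards curve with good reduction over a discretely valued field with uniformizer `ϖ` of
residue characteristic not `2`, such that the series for `℘` and `℘'` converge at `ϖ`.
The parameter `κ` is the derivative at `0` of the first coordinate of the exponential map. -/
structure ConvergentExp (d x₁ κ ϖ : K) : Prop where
  norm_two : ‖(2 : K)‖ = 1
  norm_d : ‖d‖ ≤ 1
  norm_one_sub : ‖1 - d‖ = 1
  norm_x₁ : ‖x₁‖ = 1
  kappa : κ ^ 2 * (1 - d) = 4 * x₁
  lt_one : ‖ϖ‖ < 1
  discrete : ∀ x : K, ‖x‖ < 1 → ‖x‖ ≤ ‖ϖ‖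
  converges : WpConvergesAt (g2 d x₁) (g3 d x₁) ϖ

namespace ConvergentExp

variable {d x₁ κ ϖ : K} (h : ConvergentExp d x₁ κ ϖ)
include h

theorem one_sub_ne_zero : 1 - d ≠ 0 := norm_ne_zero_iff.1 (by simp [h.norm_one_sub])

theorem norm_kappa : ‖κ‖ = 1 :=
  norm_eq_one_of_sq_mul_eq h.norm_two h.norm_one_sub h.norm_x₁ h.kappa

theorem kappa_ne_zero : κ ≠ 0 := norm_ne_zero_iff.1 (by simp [h.norm_kappa])

end ConvergentExp

variable [IsUltrametricDist K]

theorem rescale_inv {F : Type*} [Field F] (z : F) {f : F⟦X⟧} (hf : constantCoeff f ≠ 0) :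
    rescale z f⁻¹ = (rescale z f)⁻¹ := by
  rw [PowerSeries.eq_inv_iff_mul_eq_one (by rwa [constantCoeff_rescale]), ← map_mul,
    PowerSeries.inv_mul_cancel f hf, map_one]

theorem rescale_sub_one {R : Type*} [CommRing R] (z : R) (f : R⟦X⟧) :
    rescale z f - 1 = rescale z (f - 1) := by rw [map_sub, map_one]

theorem norm_pow_succ_sub_pow_succ_le {z w : K} {c : ℝ} (hz : ‖z‖ ≤ c) (hw : ‖w‖ ≤ c) (n : ℕ) :
    ‖z ^ (n + 1) - w ^ (n + 1)‖ ≤ ‖z - w‖ * c ^ n := by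
  have hc : 0 ≤ c := (norm_nonneg z).trans hz
  induction n with
  | zero => simp
  | succ n ih =>
    rw [show z ^ (n + 1 + 1) - w ^ (n + 1 + 1)
      = z * (z ^ (n + 1) - w ^ (n + 1)) + (z - w) * w ^ (n + 1) by ring]
    refine (IsUltrametricDist.norm_add_le_max _ _).trans (max_le ?_ ?_)
    · rw [norm_mul]
      calc _ ≤ c * (‖z - w‖ * c ^ n) := mul_le_mul hz ih (norm_nonneg _) hc
        _ = _ := by ring
    · rw [norm_mul, norm_pow]
      exact mul_le_mul_of_nonneg_left (pow_le_pow_left₀ (norm_nonneg w) hw _) (norm_nonneg _)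

theorem norm_one_sub_natCast_le (m : ℕ) : ‖(1 : K) - m‖ ≤ 1 :=
  (norm_sub_le_max' _ _).trans
    (max_le (by simp) (IsUltrametricDist.norm_natCast_le_one K m))

namespace IsPrincipalUnit

variable {c : ℝ} {f g : K⟦X⟧}

theorem of_norm_le [CompleteSpace K] (hf : IsPrincipalUnit c f)
    (h : ∀ n, ‖coeff n (g - 1)‖ ≤ ‖coeff n (f - 1)‖) : IsPrincipalUnit c g := by
  refine ⟨?_, fun n => (h n).trans (hf.norm_le n)⟩
  have h1 : f - 1 ∈ restrictedSeries K := sub_mem hf.mem (one_mem _)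
  have h2 : g - 1 ∈ restrictedSeries K := by
    rw [mem_restrictedSeries_iff_tendsto] at h1 ⊢
    exact squeeze_zero_norm h (tendsto_zero_iff_norm_tendsto_zero.1 h1)
  simpa using add_mem h2 (one_mem _)

theorem rescale_of_norm_le [CompleteSpace K] {z w : K}
    (hf : IsPrincipalUnit c (rescale w f)) (hz : ‖z‖ ≤ ‖w‖) :
    IsPrincipalUnit c (rescale z f) := by
  refine hf.of_norm_le fun n => ?_
  rw [rescale_sub_one, rescale_sub_one, coeff_rescale, coeff_rescale, norm_mul, norm_mul, norm_pow,
    norm_pow]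
  exact mul_le_mul_of_nonneg_right (pow_le_pow_left₀ (norm_nonneg z) hz n) (norm_nonneg _)

theorem add (hf : IsPrincipalUnit c f) (hg : g ∈ restrictedSeries K) (h : ∀ n, ‖coeff n g‖ ≤ c) :
    IsPrincipalUnit c (f + g) := by
  refine ⟨add_mem hf.mem hg, fun n => ?_⟩
  rw [add_sub_right_comm, map_add]
  exact (IsUltrametricDist.norm_add_le_max _ _).trans (max_le (hf.norm_le n) (h n))

end IsPrincipalUnit

theorem tsum_even [CompleteSpace K] {f : ℕ → K} (hf : Summable f) (h0 : ∀ n, ¬ 2 ∣ n → f n = 0) :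
    ∑' n, f n = f 0 + f 2 + ∑' j, f (2 * j + 4) := by
  have hinj : Function.Injective fun n : ℕ => 2 * n := fun a b hab => by simpa using hab
  have hsupp : Function.support f ⊆ Set.range fun n : ℕ => 2 * n := fun n hn => by
    by_contra hr
    exact hn (h0 n fun ⟨k, hk⟩ => hr ⟨k, hk.symm⟩)
  have h1 := (hf.comp_injective hinj).sum_add_tsum_nat_add 2
  rw [← hinj.tsum_eq hsupp]
  refine h1.symm.trans ?_
  simp [Finset.sum_range_succ, mul_add]

namespace ConvergentExp

variable {d x₁ κ ϖ : K} (h : ConvergentExp d x₁ κ ϖ)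
include h

theorem norm_aPrime_le : ‖aPrime d x₁‖ ≤ 1 := by
  rw [aPrime, norm_mul, norm_mul, norm_div, h.norm_two, h.norm_x₁, h.norm_one_sub, one_mul,
    one_mul, div_one]
  exact (IsUltrametricDist.norm_add_le_max _ _).trans (max_le (by simp) h.norm_d)

theorem tendsto_coeff_rescale_xSeries :
    Tendsto (fun n => coeff n (rescale ϖ (xSeries d x₁))) atTop (𝓝 0) := by
  rw [NormedAddGroup.tendsto_nhds_zero]
  intro ε hε
  have h1 := NormedAddGroup.tendsto_nhds_zero.1 h.converges.1.tendsto_atTop_zero ε hε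
  obtain ⟨J, hJ⟩ := eventually_atTop.1 h1
  filter_upwards [eventually_ge_atTop (2 * J + 4)] with n hn
  by_cases hev : 2 ∣ n
  · obtain ⟨j, rfl⟩ : ∃ j, n = 2 * j + 4 := by
      obtain ⟨k, rfl⟩ := hev
      exact ⟨k - 2, by omega⟩
    have h2 := hJ j (by omega)
    rw [coeff_rescale, coeff_xSeries_two_mul_add_four]
    have h3 : ϖ ^ (2 * j + 4) * wpCoeff (g2 d x₁) (g3 d x₁) (j + 2)
        = ϖ ^ 2 * wpTerm (g2 d x₁) (g3 d x₁) ϖ j := by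
      rw [wpTerm]
      ring
    rw [h3, norm_mul, norm_pow]
    exact (mul_le_of_le_one_left (norm_nonneg _)
      (pow_le_one₀ (norm_nonneg _) h.lt_one.le)).trans_lt h2
  · simpa [coeff_rescale, coeff_xSeries_of_odd hev] using hε

variable [CompleteSpace K] [CharZero K]

/-- If the maximal norm of the coefficients of `f = ϖ² s² x(ϖ s)` were attained last at an index
`N > 0`, then the coefficient of `s^(3N)` in the Weierstrass equation would be dominated by that
of `f³`, which is absurd. Hence all coefficients but the constant one have norm less than `1`. -/
theorem isPrincipalUnit_rescale_uniformizer_xSeries :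
    IsPrincipalUnit ‖ϖ‖ (rescale ϖ (xSeries d x₁)) := by
  have hlim := h.tendsto_coeff_rescale_xSeries
  have heq := congrArg (rescale ϖ) (ySeries_sq (d := d) (x₁ := x₁))
  have hf0 : constantCoeff (rescale ϖ (xSeries d x₁)) = 1 := by
    rw [constantCoeff_rescale, constantCoeff_xSeries]
  have hg : ∀ n, ‖coeff n (rescale ϖ (ySeries d x₁))‖ ≤ ‖coeff n (rescale ϖ (xSeries d x₁))‖ := by
    intro n
    rw [coeff_rescale, coeff_rescale, norm_mul, norm_mul]
    refine mul_le_mul_of_nonneg_left ?_ (norm_nonneg _)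
    by_cases hev : 2 ∣ n
    · obtain ⟨m, rfl⟩ := hev
      rw [coeff_ySeries_two_mul, norm_mul]
      exact mul_le_of_le_one_left (norm_nonneg _) (norm_one_sub_natCast_le m)
    · rw [coeff_ySeries_of_odd hev, norm_zero]
      exact norm_nonneg _
  simp only [map_pow, map_add, map_mul, rescale_C, rescale_X] at heq
  generalize rescale ϖ (xSeries d x₁) = f at *
  generalize rescale ϖ (ySeries d x₁) = g at *
  obtain ⟨N, hN⟩ := IsLastMaxIndex.exists_of_tendsto (ne_zero_of_constantCoeff_eq_one hf0) hlim
  have hM : 1 ≤ ‖coeff N f‖ := by simpa [hf0] using hN.le 0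
  have hN0 : N = 0 := by
    by_contra hN0
    have hMne : coeff N f ≠ 0 := norm_pos_iff.1 (zero_lt_one.trans_le hM)
    have hsq := hN.mul hN hMne hMne
    have hsqn := hN.norm_coeff_mul hN hMne hMne
    have hcube := hsq.norm_coeff_mul hN (norm_pos_iff.1 (by rw [hsqn]; positivity)) hMne
    rw [hsqn] at hcube
    have hmul : f * f * f = g * g - (C (aPrime d x₁ * ϖ ^ 2) * (X ^ 2 * (f * f))
        + C (bPrime x₁ * ϖ ^ 4) * (X ^ 4 * f)) := by
      simp only [map_mul, map_pow]
      linear_combination -heq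
    set M := ‖coeff N f‖ with hMdef
    have hshift : ∀ (k n : ℕ) (p : K⟦X⟧) (B : ℝ), (∀ n, ‖coeff n p‖ ≤ B) →
        ‖coeff n (X ^ k * p)‖ ≤ B := fun k n p B hp => by
      rw [coeff_X_pow_mul']
      split_ifs
      · exact hp _
      · simpa using (norm_nonneg _).trans (hp 0)
    have hMM : M ≤ M * M := by nlinarith
    have hϖ : ‖ϖ‖ ^ 2 < 1 := pow_lt_one₀ (norm_nonneg _) h.lt_one two_ne_zero
    have hϖ4 : ‖ϖ‖ ^ 4 < 1 := pow_lt_one₀ (norm_nonneg _) h.lt_one four_ne_zero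
    have hlt : ‖coeff (N + N + N) (f * f * f)‖ < M * M := by
      rw [hmul, map_sub, map_add, coeff_C_mul, coeff_C_mul]
      refine (norm_sub_le_max' _ _).trans_lt (max_lt ?_
        ((IsUltrametricDist.norm_add_le_max _ _).trans_lt (max_lt ?_ ?_)))
      · rw [coeff_mul]
        refine norm_sum_lt_of_forall_lt (by positivity) fun p hp => ?_
        rw [mem_antidiagonal] at hp
        rw [norm_mul]
        rcases lt_or_ge N p.1 with h1 | h1
        · exact mul_lt_mul_of_lt_of_le_of_nonneg_of_pos ((hg _).trans_lt (hN.lt _ h1))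
            ((hg _).trans (hN.le _)) (norm_nonneg _) (by positivity)
        · exact mul_lt_mul' ((hg _).trans (hN.le _)) ((hg _).trans_lt (hN.lt _ (by omega)))
            (norm_nonneg _) (by positivity)
      · rw [norm_mul, norm_mul, norm_pow]
        have h1 := hshift 2 (N + N + N) (f * f) (M * M) fun n => hsqn ▸ hsq.le n
        have h2 : ‖aPrime d x₁‖ * ‖ϖ‖ ^ 2 < 1 :=
          (mul_le_of_le_one_left (by positivity) h.norm_aPrime_le).trans_lt hϖ
        calc _ ≤ ‖aPrime d x₁‖ * ‖ϖ‖ ^ 2 * (M * M) := mul_le_mul_of_nonneg_left h1 (by positivity)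
          _ < 1 * (M * M) := mul_lt_mul_of_pos_right h2 (by positivity)
          _ = M * M := one_mul _
      · rw [norm_mul, norm_mul, norm_pow, bPrime, norm_pow, h.norm_x₁, one_pow, one_mul]
        have h1 := hshift 4 (N + N + N) f M hN.le
        calc _ ≤ ‖ϖ‖ ^ 4 * M := mul_le_mul_of_nonneg_left h1 (by positivity)
          _ < 1 * M := mul_lt_mul_of_pos_right hϖ4 (by positivity)
          _ ≤ M * M := by rwa [one_mul]
    rw [hcube] at hlt
    nlinarith [mul_pos (zero_lt_one.trans_le hM) (zero_lt_one.trans_le hM)]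
  subst hN0
  refine ⟨mem_restrictedSeries_iff_tendsto.2 hlim, fun n => ?_⟩
  rcases Nat.eq_zero_or_pos n with rfl | hn
  · simp [hf0]
  · rw [map_sub, coeff_one, if_neg hn.ne', sub_zero]
    refine h.discrete _ ((hN.lt n hn).trans_eq ?_)
    simp [hf0]

variable {z w : K}

theorem isPrincipalUnit_xSeries (hz : ‖z‖ ≤ ‖ϖ‖) :
    IsPrincipalUnit ‖ϖ‖ (rescale z (xSeries d x₁)) :=
  h.isPrincipalUnit_rescale_uniformizer_xSeries.rescale_of_norm_le hz

theorem isPrincipalUnit_ySeries (hz : ‖z‖ ≤ ‖ϖ‖) :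
    IsPrincipalUnit ‖ϖ‖ (rescale z (ySeries d x₁)) := by
  refine (h.isPrincipalUnit_xSeries hz).of_norm_le fun n => ?_
  rw [rescale_sub_one, rescale_sub_one, coeff_rescale, coeff_rescale, norm_mul, norm_mul]
  refine mul_le_mul_of_nonneg_left ?_ (norm_nonneg _)
  rcases Nat.eq_zero_or_pos n with rfl | hn
  · simp [constantCoeff_xSeries, constantCoeff_ySeries]
  rw [map_sub, map_sub, coeff_one, if_neg hn.ne', sub_zero, sub_zero]
  by_cases hev : 2 ∣ n
  · obtain ⟨m, rfl⟩ := hev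
    rw [coeff_ySeries_two_mul, norm_mul]
    exact mul_le_of_le_one_left (norm_nonneg _) (norm_one_sub_natCast_le m)
  · rw [coeff_ySeries_of_odd hev, norm_zero]
    exact norm_nonneg _

theorem isPrincipalUnit_xSeries_add {a : K} (ha : ‖a‖ ≤ 1) (hz : ‖z‖ ≤ ‖ϖ‖) :
    IsPrincipalUnit ‖ϖ‖ (rescale z (xSeries d x₁ + C a * X ^ 2)) := by
  rw [map_add, map_mul, map_pow, rescale_C, rescale_X]
  have e : C a * (C z * X) ^ 2 = C (a * z ^ 2) * X ^ 2 := by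
    simp only [map_mul, map_pow]
    ring
  rw [e]
  refine (h.isPrincipalUnit_xSeries hz).add
    (mul_mem (C_mem_restrictedSeries _) (pow_mem X_mem_restrictedSeries 2)) fun n => ?_
  rw [coeff_C_mul, coeff_X_pow]
  split_ifs
  · rw [mul_one, norm_mul, norm_pow]
    have h1 : ‖z‖ ^ 2 ≤ ‖z‖ := pow_le_of_le_one (norm_nonneg z) (hz.trans h.lt_one.le) two_ne_zero
    exact (mul_le_of_le_one_left (by positivity) ha).trans (h1.trans hz)
  · simp

theorem isPrincipalUnit_quotient (hz : ‖z‖ ≤ ‖ϖ‖) :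
    IsPrincipalUnit ‖ϖ‖ (rescale z (xSeries d x₁ * (ySeries d x₁)⁻¹)) := by
  rw [map_mul, rescale_inv z (by simp [constantCoeff_ySeries])]
  exact (h.isPrincipalUnit_xSeries hz).mul ((h.isPrincipalUnit_ySeries hz).inv h.lt_one) h.lt_one

theorem isPrincipalUnit_vSeries (hz : ‖z‖ ≤ ‖ϖ‖) :
    IsPrincipalUnit ‖ϖ‖ (rescale z (vSeries d x₁)) := by
  rw [vSeries, map_mul, rescale_inv z (by simp [constantCoeff_xSeries_add]), sub_eq_add_neg,
    ← neg_mul, ← map_neg C]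
  exact (h.isPrincipalUnit_xSeries_add (by simp [h.norm_x₁]) hz).mul
    ((h.isPrincipalUnit_xSeries_add h.norm_x₁.le hz).inv h.lt_one) h.lt_one

theorem uSeries_mem (hz : ‖z‖ ≤ ‖ϖ‖) : rescale z (uSeries d x₁ κ) ∈ restrictedSeries K := by
  rw [rescale_uSeries]
  exact mul_mem (mul_mem (C_mem_restrictedSeries _) X_mem_restrictedSeries)
    (h.isPrincipalUnit_quotient hz).mem

theorem evalOne_uSeries (hz : ‖z‖ ≤ ‖ϖ‖) :
    evalOne K ⟨_, h.uSeries_mem hz⟩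
      = κ * z * evalOne K ⟨_, (h.isPrincipalUnit_quotient hz).mem⟩ := by
  have e : (⟨_, h.uSeries_mem hz⟩ : restrictedSeries K)
      = ⟨_, C_mem_restrictedSeries (κ * z)⟩ * ⟨_, X_mem_restrictedSeries⟩
        * ⟨_, (h.isPrincipalUnit_quotient hz).mem⟩ := Subtype.ext (rescale_uSeries z)
  rw [e, map_mul, map_mul, evalOne_C, evalOne_X, mul_one]

/-- The point of the Edwards curve with coordinates the values at `z` of the two series. -/
def point (hd : ¬ IsSquare d) (hz : ‖z‖ ≤ ‖ϖ‖) : J0 d hd where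
  x := evalOne K ⟨_, h.uSeries_mem hz⟩
  y := evalOne K ⟨_, (h.isPrincipalUnit_vSeries hz).mem⟩
  on_curve := by
    have e : (⟨_, h.uSeries_mem hz⟩ : restrictedSeries K) ^ 2
        + ⟨_, (h.isPrincipalUnit_vSeries hz).mem⟩ ^ 2 = 1 + ⟨_, C_mem_restrictedSeries d⟩
          * ⟨_, h.uSeries_mem hz⟩ ^ 2 * ⟨_, (h.isPrincipalUnit_vSeries hz).mem⟩ ^ 2 :=
      Subtype.ext (rescale_curve h.one_sub_ne_zero h.kappa z)
    simpa only [map_add, map_mul, map_pow, map_one, evalOne_C] using congrArg (evalOne K) e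

variable {hd : ¬ IsSquare d}

theorem point_add (hz : ‖z‖ ≤ ‖ϖ‖) (hw : ‖w‖ ≤ ‖ϖ‖) (hzw : ‖z + w‖ ≤ ‖ϖ‖) :
    h.point hd hzw = h.point hd hz + h.point hd hw := by
  obtain ⟨e1, e2⟩ := rescale_add_uSeries_vSeries h.one_sub_ne_zero h.kappa z w rfl rfl rfl rfl
  have e1' : (⟨_, h.uSeries_mem hzw⟩ : restrictedSeries K)
      * (1 + ⟨_, C_mem_restrictedSeries d⟩ * ⟨_, h.uSeries_mem hz⟩ * ⟨_, h.uSeries_mem hw⟩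
        * ⟨_, (h.isPrincipalUnit_vSeries hz).mem⟩ * ⟨_, (h.isPrincipalUnit_vSeries hw).mem⟩)
      = ⟨_, h.uSeries_mem hz⟩ * ⟨_, (h.isPrincipalUnit_vSeries hw).mem⟩
        + ⟨_, h.uSeries_mem hw⟩ * ⟨_, (h.isPrincipalUnit_vSeries hz).mem⟩ := Subtype.ext e1
  have e2' : (⟨_, (h.isPrincipalUnit_vSeries hzw).mem⟩ : restrictedSeries K)
      * (1 - ⟨_, C_mem_restrictedSeries d⟩ * ⟨_, h.uSeries_mem hz⟩ * ⟨_, h.uSeries_mem hw⟩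
        * ⟨_, (h.isPrincipalUnit_vSeries hz).mem⟩ * ⟨_, (h.isPrincipalUnit_vSeries hw).mem⟩)
      = ⟨_, (h.isPrincipalUnit_vSeries hz).mem⟩ * ⟨_, (h.isPrincipalUnit_vSeries hw).mem⟩
        - ⟨_, h.uSeries_mem hz⟩ * ⟨_, h.uSeries_mem hw⟩ := Subtype.ext e2
  replace e1' := congrArg (evalOne K) e1'
  replace e2' := congrArg (evalOne K) e2'
  simp only [map_add, map_sub, map_mul, map_one, evalOne_C] at e1' e2'
  ext
  · rw [add_x, eq_div_iff (Edwards.one_add_ne_zero _ _)]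
    exact e1'
  · rw [add_y, eq_div_iff (Edwards.one_sub_ne_zero _ _)]
    exact e2'

theorem norm_point_x (hz : ‖z‖ ≤ ‖ϖ‖) : ‖(h.point hd hz).x‖ = ‖z‖ := by
  change ‖evalOne K ⟨_, h.uSeries_mem hz⟩‖ = _
  rw [h.evalOne_uSeries hz, norm_mul, norm_mul, h.norm_kappa,
    (h.isPrincipalUnit_quotient hz).norm_evalOne h.lt_one, one_mul, mul_one]

theorem norm_point_y_sub_one (hz : ‖z‖ ≤ ‖ϖ‖) : ‖(h.point hd hz).y - 1‖ < 1 :=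
  (h.isPrincipalUnit_vSeries hz).norm_evalOne_sub_one_le.trans_lt h.lt_one

theorem hasSum_quotient_sub_one (hz : ‖z‖ ≤ ‖ϖ‖) :
    HasSum (fun n => z ^ n * coeff n (xSeries d x₁ * (ySeries d x₁)⁻¹ - 1))
      (evalOne K ⟨_, (h.isPrincipalUnit_quotient hz).mem⟩ - 1) := by
  have hmem := sub_mem (h.isPrincipalUnit_quotient hz).mem (one_mem (restrictedSeries K))
  have e : evalOne K ⟨_, (h.isPrincipalUnit_quotient hz).mem⟩ - 1 = evalOne K ⟨_, hmem⟩ := by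
    rw [← map_one (evalOne K), ← map_sub]
    rfl
  rw [e, evalOne_mk]
  convert (mem_restrictedSeries.1 hmem).hasSum using 2 with n
  rw [rescale_sub_one, coeff_rescale]

/-- The first coordinate of the exponential map takes all values of norm at most `‖ϖ‖`: it differs
from `z ↦ κ z` by a contraction. -/
theorem exists_point_x_eq {c : K} (hc : ‖c‖ ≤ ‖ϖ‖) :
    ∃ (z : K) (hz : ‖z‖ ≤ ‖ϖ‖), (h.point hd hz).x = c := by
  set H : K⟦X⟧ := xSeries d x₁ * (ySeries d x₁)⁻¹ - 1 with hH
  let s : Set K := Metric.closedBall 0 ‖ϖ‖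
  have hs : ∀ {t : K}, t ∈ s ↔ ‖t‖ ≤ ‖ϖ‖ := by simp [s]
  let φ : K → K := fun t => c / κ - ∑' n, t ^ (n + 1) * coeff n H
  have hsum : ∀ {t : K} (ht : ‖t‖ ≤ ‖ϖ‖), HasSum (fun n => t ^ (n + 1) * coeff n H)
      (t * (evalOne K ⟨_, (h.isPrincipalUnit_quotient ht).mem⟩ - 1)) := fun {t} ht => by
    have h1 := (h.hasSum_quotient_sub_one ht).mul_left t
    rw [← hH] at h1
    simpa only [pow_succ', mul_assoc] using h1
  have hlip : ∀ {t t' : K}, ‖t‖ ≤ ‖ϖ‖ → ‖t'‖ ≤ ‖ϖ‖ →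
      ‖∑' n, t ^ (n + 1) * coeff n H - ∑' n, t' ^ (n + 1) * coeff n H‖ ≤ ‖ϖ‖ * ‖t - t'‖ := by
    intro t t' ht ht'
    rw [← (hsum ht).summable.tsum_sub (hsum ht').summable]
    refine IsUltrametricDist.norm_tsum_le_of_forall_le_of_nonneg (by positivity) fun n => ?_
    have h1 := (h.isPrincipalUnit_quotient le_rfl).norm_le n
    rw [rescale_sub_one, coeff_rescale, ← hH, norm_mul, norm_pow] at h1
    rw [← sub_mul, norm_mul]
    calc _ ≤ ‖t - t'‖ * ‖ϖ‖ ^ n * ‖coeff n H‖ :=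
          mul_le_mul_of_nonneg_right (norm_pow_succ_sub_pow_succ_le ht ht' n) (norm_nonneg _)
      _ = (‖ϖ‖ ^ n * ‖coeff n H‖) * ‖t - t'‖ := by ring
      _ ≤ _ := mul_le_mul_of_nonneg_right h1 (norm_nonneg _)
  have hmap : Set.MapsTo φ s s := by
    intro t ht
    rw [hs] at ht ⊢
    refine (norm_sub_le_max' _ _).trans (max_le (by rwa [norm_div, h.norm_kappa, div_one]) ?_)
    have h1 := hlip ht (t' := 0) (by simp)
    simp only [zero_pow (Nat.succ_ne_zero _), zero_mul, tsum_zero, sub_zero] at h1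
    exact h1.trans ((mul_le_of_le_one_left (norm_nonneg _) h.lt_one.le).trans ht)
  have hcontr : ContractingWith ‖ϖ‖₊ (hmap.restrict φ s s) := by
    refine ⟨by exact_mod_cast h.lt_one, LipschitzWith.of_dist_le_mul fun a b => ?_⟩
    change dist (φ a) (φ b) ≤ ‖ϖ‖ * dist (a : K) (b : K)
    rw [dist_eq_norm, dist_eq_norm, sub_sub_sub_cancel_left, norm_sub_rev (a : K)]
    exact hlip (hs.1 b.2) (hs.1 a.2)
  obtain ⟨t, hts, ht, -⟩ := hcontr.exists_fixedPoint' (Metric.isClosed_closedBall.isComplete) hmap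
    (x := 0) (hs.2 (by simp)) (edist_ne_top _ _)
  have htϖ := hs.1 hts
  refine ⟨t, htϖ, ?_⟩
  change c / κ - ∑' n, t ^ (n + 1) * coeff n H = t at ht
  rw [(hsum htϖ).tsum_eq, sub_eq_iff_eq_add, div_eq_iff h.kappa_ne_zero] at ht
  change evalOne K ⟨_, h.uSeries_mem htϖ⟩ = c
  rw [h.evalOne_uSeries htϖ, ht]
  ring

theorem three_mul_wp_sub (hz : ‖z‖ ≤ ‖ϖ‖) (hz0 : z ≠ 0) :
    3 * wp (g2 d x₁) (g3 d x₁) z - aPrime d x₁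
      = 3 * evalOne K ⟨_, (h.isPrincipalUnit_xSeries hz).mem⟩ / z ^ 2 := by
  rw [evalOne_mk, tsum_even (mem_restrictedSeries.1 (h.isPrincipalUnit_xSeries hz).mem)
    fun n hn => by rw [coeff_rescale, coeff_xSeries_of_odd hn, mul_zero]]
  have e : ∑' j, coeff (2 * j + 4) (rescale z (xSeries d x₁))
      = z ^ 2 * ∑' j, wpTerm (g2 d x₁) (g3 d x₁) z j := by
    rw [← tsum_mul_left]
    refine tsum_congr fun j => ?_
    rw [coeff_rescale, coeff_xSeries_two_mul_add_four, wpTerm]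
    ring
  rw [e, coeff_rescale, coeff_rescale, coeff_xSeries_two, coeff_zero_eq_constantCoeff_apply,
    constantCoeff_xSeries, wp]
  field_simp
  ring

theorem wpDeriv_eq (hz : ‖z‖ ≤ ‖ϖ‖) (hz0 : z ≠ 0) :
    wpDeriv (g2 d x₁) (g3 d x₁) z
      = -2 * evalOne K ⟨_, (h.isPrincipalUnit_ySeries hz).mem⟩ / z ^ 3 := by
  rw [evalOne_mk, tsum_even (mem_restrictedSeries.1 (h.isPrincipalUnit_ySeries hz).mem)
    fun n hn => by rw [coeff_rescale, coeff_ySeries_of_odd hn, mul_zero]]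
  have e : ∑' j, coeff (2 * j + 4) (rescale z (ySeries d x₁))
      = -(z ^ 3 / 2) * ∑' j, wpDerivTerm (g2 d x₁) (g3 d x₁) z j := by
    rw [← tsum_mul_left]
    refine tsum_congr fun j => ?_
    rw [coeff_rescale, show 2 * j + 4 = 2 * (j + 2) by ring, coeff_ySeries_two_mul,
      show 2 * (j + 2) = 2 * j + 4 by ring, coeff_xSeries_two_mul_add_four, wpDerivTerm]
    push_cast
    ring
  have e2 : coeff 2 (ySeries d x₁) = 0 := by
    have := coeff_ySeries_two_mul (d := d) (x₁ := x₁) 1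
    simpa using this
  rw [e, coeff_rescale, coeff_rescale, e2, coeff_zero_eq_constantCoeff_apply,
    constantCoeff_ySeries, wpDeriv]
  field_simp
  ring

end ConvergentExp

end ExpMap

/-! ### The reduction map -/

section ReductionMap

variable {K : Type*} [NontriviallyNormedField K] [IsUltrametricDist K]

theorem res_eq_zero_iff {x : ringOfIntegers K} : res x = 0 ↔ ‖(x : K)‖ < 1 :=
  ⟨norm_lt_one_of_res_eq_zero, fun hx => by
    by_contra h0
    exact hx.ne (norm_eq_one_of_res_ne_zero h0)⟩

theorem res_eq_res_iff {x y : ringOfIntegers K} : res x = res y ↔ ‖(x : K) - y‖ < 1 := by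
  rw [← sub_eq_zero, ← map_sub, res_eq_zero_iff]
  rfl

theorem mem_maxIdeal_iff {x : ringOfIntegers K} : x ∈ maxIdeal K ↔ ‖(x : K)‖ < 1 := by
  rw [← IsLocalRing.residue_eq_zero_iff, res_eq_zero_iff]

/-- A `1`-unit has a square root which is a `1`-unit. -/
theorem exists_sq_eq_of_norm_sub_one_lt [CompleteSpace K] (h2 : ‖(2 : K)‖ = 1) {u : K}
    (hu : ‖u - 1‖ < 1) : ∃ t : K, t ^ 2 = u ∧ ‖t - 1‖ < 1 := by
  obtain ⟨t, rfl⟩ := isSquare_of_norm_sub_one_lt h2 hu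
  rw [show t * t - 1 = (t - 1) * (t + 1) by ring, norm_mul] at hu
  by_cases ht : ‖t - 1‖ < 1
  · exact ⟨t, sq t, ht⟩
  · refine ⟨-t, by ring, ?_⟩
    rw [show -t - 1 = -(t + 1) by ring, norm_neg]
    rw [not_lt] at ht
    nlinarith [norm_nonneg (t + 1)]

/-- Hensel's lemma for the Edwards curve: if `x̄ ≠ 0`, any lift of `ȳ` is the second coordinate of
a point reducing to `(x̄, ȳ)`, since the equation is `x² = (1 - y²) / (1 - d y²)`. -/
theorem reduction_surjective [CompleteSpace K] (h2 : (2 : resField K) ≠ 0) {d : ringOfIntegers K}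
    (hd : ¬ IsSquare (d : K)) (hr : ¬ IsSquare (res d)) :
    Function.Surjective (reduction hd hr) := by
  have hn2 : ‖(2 : K)‖ = 1 := by
    exact_mod_cast norm_natCast_eq_one_of_res_ne_zero (K := K) (n := 2) (by exact_mod_cast h2)
  intro Q
  obtain ⟨Y, hY⟩ := IsLocalRing.residue_surjective Q.y
  obtain ⟨Z, hZ⟩ := IsLocalRing.residue_surjective Q.x
  have hcurve := Q.on_curve
  by_cases hx : Q.x = 0
  · have hy : Q.y ^ 2 = 1 := by
      rw [hx] at hcurve
      linear_combination hcurve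
    rcases mul_self_eq_one_iff.1 ((sq Q.y).symm.trans hy) with hy | hy
    · exact ⟨0, by rw [map_zero]; ext <;> simp [zero_x, zero_y, hx, hy]⟩
    · refine ⟨⟨0, -1, by ring⟩, ?_⟩
      ext
      · exact (map_zero (res (K := K))).trans hx.symm
      · refine Eq.trans ?_ hy.symm
        rw [← map_one (res (K := K)), ← map_neg]
        rfl
  · have hZ1 : ‖(Z : K)‖ = 1 := norm_eq_one_of_res_ne_zero (by rwa [hZ])
    have hden : res (1 - d * Y ^ 2) ≠ 0 := by
      intro h0
      rw [map_sub, map_mul, map_pow, map_one, hY, sub_eq_zero] at h0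
      have hQy : Q.y ≠ 0 := by
        intro h1
        simp [h1] at h0
      exact hr ⟨Q.y⁻¹, by field_simp; exact h0.symm⟩
    have hden1 := norm_eq_one_of_res_ne_zero hden
    have hnum : ‖((1 - Y ^ 2 - Z ^ 2 * (1 - d * Y ^ 2) : ringOfIntegers K) : K)‖ < 1 := by
      rw [← res_eq_zero_iff]
      simp only [map_sub, map_mul, map_pow, map_one, hY, hZ]
      linear_combination -hcurve
    push_cast at hden1 hnum
    have hZ0 : (Z : K) ≠ 0 := norm_ne_zero_iff.1 (by simp [hZ1])
    have hden0 : 1 - (d : K) * Y ^ 2 ≠ 0 := norm_ne_zero_iff.1 (by simp [hden1])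
    obtain ⟨t, ht, ht1⟩ := exists_sq_eq_of_norm_sub_one_lt hn2
      (u := (1 - (Y : K) ^ 2) / (Z ^ 2 * (1 - d * Y ^ 2))) (by
        rw [div_sub_one (mul_ne_zero (pow_ne_zero 2 hZ0) hden0), norm_div, norm_mul, norm_pow, hZ1,
          hden1]
        simpa using hnum)
    rw [eq_div_iff (mul_ne_zero (pow_ne_zero 2 hZ0) hden0)] at ht
    refine ⟨⟨Z * t, Y, by linear_combination ht⟩, ?_⟩
    ext
    · refine Eq.trans ?_ hZ
      refine res_eq_res_iff.2 ?_
      change ‖(Z : K) * t - Z‖ < 1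
      rwa [← mul_sub_one, norm_mul, hZ1, one_mul]
    · exact hY

/-- The kernel of reduction: `x ≡ 0` and `y ≡ 1`. -/
theorem reduction_eq_zero_iff {d : ringOfIntegers K} (hd : ¬ IsSquare (d : K))
    (hr : ¬ IsSquare (res d)) (P : J0 (d : K) hd) :
    reduction hd hr P = 0 ↔ ‖P.x‖ < 1 ∧ ‖P.y - 1‖ < 1 := by
  rw [J0.ext_iff]
  refine and_congr (res_eq_zero_iff (K := K)) ?_
  rw [zero_y, ← map_one (res (K := K))]
  exact res_eq_res_iff

/-- In the kernel of reduction a point is determined by its first coordinate. -/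
theorem eq_of_x_eq (h2 : ‖(2 : K)‖ = 1) {d : K} {hd : ¬ IsSquare d} {P Q : J0 d hd}
    (hx : P.x = Q.x) (hP : ‖P.y - 1‖ < 1) (hQ : ‖Q.y - 1‖ < 1) : P = Q := by
  refine J0.ext hx ?_
  have hPc := P.on_curve
  have hQc := Q.on_curve
  rw [hx] at hPc
  have hne : 1 - d * Q.x ^ 2 ≠ 0 := by
    intro h0
    by_cases hx0 : Q.x = 0
    · simp [hx0] at h0
    · exact hd ⟨Q.x⁻¹, by field_simp; linear_combination -h0⟩
  have h1 : (P.y - Q.y) * (P.y + Q.y) = 0 := by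
    refine (mul_eq_zero.1 ?_).resolve_left hne
    linear_combination hPc - hQc
  refine sub_eq_zero.1 ((mul_eq_zero.1 h1).resolve_right fun h0 => ?_)
  have h3 : (2 : K) = -((P.y - 1) + (Q.y - 1)) := by linear_combination h0
  have h4 : ‖(2 : K)‖ < 1 := by
    rw [h3, norm_neg]
    exact (IsUltrametricDist.norm_add_le_max _ _).trans_lt (max_lt hP hQ)
  exact h4.ne h2

end ReductionMap

/-! ### The exact sequence -/

namespace ConvergentExp

variable {K : Type*} [NontriviallyNormedField K] [IsUltrametricDist K] [CompleteSpace K]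
  [CharZero K] {d x₁ κ ϖ z : K} (h : ConvergentExp d x₁ κ ϖ)
include h

theorem wpDeriv_ne_zero (hz : ‖z‖ ≤ ‖ϖ‖) (hz0 : z ≠ 0) :
    wpDeriv (g2 d x₁) (g3 d x₁) z ≠ 0 := by
  rw [h.wpDeriv_eq hz hz0]
  exact div_ne_zero (mul_ne_zero (by norm_num)
    ((h.isPrincipalUnit_ySeries hz).evalOne_ne_zero h.lt_one)) (pow_ne_zero 3 hz0)

theorem evalOne_xSeries_add {a : K} (ha : ‖a‖ ≤ 1) (hz : ‖z‖ ≤ ‖ϖ‖) :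
    evalOne K ⟨_, (h.isPrincipalUnit_xSeries_add ha hz).mem⟩
      = evalOne K ⟨_, (h.isPrincipalUnit_xSeries hz).mem⟩ + a * z ^ 2 := by
  have e : (⟨_, (h.isPrincipalUnit_xSeries_add ha hz).mem⟩ : restrictedSeries K)
      = ⟨_, (h.isPrincipalUnit_xSeries hz).mem⟩ + ⟨_, C_mem_restrictedSeries (a * z ^ 2)⟩
        * ⟨_, X_mem_restrictedSeries⟩ ^ 2 := by
    refine Subtype.ext ?_
    change rescale z (xSeries d x₁ + C a * X ^ 2) = rescale z (xSeries d x₁)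
      + C (a * z ^ 2) * X ^ 2
    rw [map_add, map_mul, map_pow, rescale_C, rescale_X]
    simp only [map_mul, map_pow]
    ring
  rw [e, map_add, map_mul, map_pow, evalOne_C, evalOne_X, one_pow, mul_one]

theorem evalOne_xSeries_add_ne_zero (hz : ‖z‖ ≤ ‖ϖ‖) :
    evalOne K ⟨_, (h.isPrincipalUnit_xSeries hz).mem⟩ + x₁ * z ^ 2 ≠ 0 := by
  rw [← h.evalOne_xSeries_add h.norm_x₁.le hz]
  exact (h.isPrincipalUnit_xSeries_add h.norm_x₁.le hz).evalOne_ne_zero h.lt_one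

theorem wp_add_ne_zero (hz : ‖z‖ ≤ ‖ϖ‖) (hz0 : z ≠ 0) :
    3 * wp (g2 d x₁) (g3 d x₁) z - aPrime d x₁ + 3 * x₁ ≠ 0 := by
  have h1 := h.evalOne_xSeries_add_ne_zero hz
  rw [h.three_mul_wp_sub hz hz0]
  set e := evalOne K ⟨_, (h.isPrincipalUnit_xSeries hz).mem⟩
  have h2 : 3 * e / z ^ 2 + 3 * x₁ = 3 * (e + x₁ * z ^ 2) / z ^ 2 := by field_simp
  rw [h2]
  exact div_ne_zero (mul_ne_zero three_ne_zero h1) (pow_ne_zero 2 hz0)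

variable {hd : ¬ IsSquare d}

theorem point_x_eq_expX (hz : ‖z‖ ≤ ‖ϖ‖) (hz0 : z ≠ 0) {y₁ : K} (hy₁ : κ = -(y₁ / x₁)) :
    (h.point hd hz).x = expX d x₁ y₁ z := by
  have hx₁ : x₁ ≠ 0 := norm_ne_zero_iff.1 (by simp [h.norm_x₁])
  have hne := (h.isPrincipalUnit_ySeries hz).evalOne_ne_zero h.lt_one
  have e : (⟨_, (h.isPrincipalUnit_quotient hz).mem⟩ : restrictedSeries K)
      * ⟨_, (h.isPrincipalUnit_ySeries hz).mem⟩ = ⟨_, (h.isPrincipalUnit_xSeries hz).mem⟩ := by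
    refine Subtype.ext ?_
    change rescale z _ * rescale z _ = rescale z _
    rw [← map_mul, mul_assoc, PowerSeries.inv_mul_cancel _ (by simp [constantCoeff_ySeries]),
      mul_one]
  replace e := congrArg (evalOne K) e
  rw [map_mul, ← eq_div_iff hne] at e
  change evalOne K ⟨_, h.uSeries_mem hz⟩ = _
  rw [h.evalOne_uSeries hz, e, expX, h.three_mul_wp_sub hz hz0, h.wpDeriv_eq hz hz0]
  generalize evalOne K ⟨_, (h.isPrincipalUnit_xSeries hz).mem⟩ = F
  generalize evalOne K ⟨_, (h.isPrincipalUnit_ySeries hz).mem⟩ = G at hne ⊢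
  rw [hy₁]
  field_simp

theorem point_y_eq_expY (hz : ‖z‖ ≤ ‖ϖ‖) (hz0 : z ≠ 0) :
    (h.point hd hz).y = expY d x₁ z := by
  have hx : ‖-x₁‖ ≤ 1 := by simp [h.norm_x₁]
  have e : (⟨_, (h.isPrincipalUnit_vSeries hz).mem⟩ : restrictedSeries K)
      * ⟨_, (h.isPrincipalUnit_xSeries_add h.norm_x₁.le hz).mem⟩
      = ⟨_, (h.isPrincipalUnit_xSeries_add hx hz).mem⟩ := by
    refine Subtype.ext ?_
    change rescale z _ * rescale z _ = rescale z _
    rw [← map_mul, mul_comm, mul_vSeries, map_neg, neg_mul, ← sub_eq_add_neg]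
  replace e := congrArg (evalOne K) e
  have hne := h.evalOne_xSeries_add_ne_zero hz
  rw [map_mul, h.evalOne_xSeries_add h.norm_x₁.le hz, h.evalOne_xSeries_add hx hz,
    ← eq_div_iff hne] at e
  change evalOne K ⟨_, (h.isPrincipalUnit_vSeries hz).mem⟩ = _
  rw [e, expY, h.three_mul_wp_sub hz hz0]
  have hne' := h.wp_add_ne_zero hz hz0
  rw [h.three_mul_wp_sub hz hz0] at hne'
  rw [div_eq_div_iff hne hne']
  field_simp
  ring

end ConvergentExp

end Edwards

end

theorem mainTheorem2 {K : Type*} [NontriviallyNormedField K] [IsUltrametricDist K]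
    [CompleteSpace K] [CharZero K] [IsDiscreteValuationRing (Edwards.ringOfIntegers K)]
    (h2 : (2 : Edwards.resField K) ≠ 0)
    (d x₁ : Edwards.ringOfIntegers K) (y₁ : K)
    (hd : Edwards.res d * (Edwards.res d - 1) ≠ 0)
    (hd_sq : ¬ IsSquare (d : K))
    (hx₁ : Edwards.res x₁ ≠ 0)
    (hy₁ : y₁ ^ 2 = 4 * (x₁ : K) ^ 3 / (1 - (d : K))) :
    -- the series converge on the whole of `𝔪_K` if the ramification index is less than `p - 1`
    ((∀ p : ℕ, p.Prime → CharP (Edwards.resField K) p →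
        ∀ z : Edwards.maxIdeal K, ‖(z.1 : K)‖ ^ (p - 1) < ‖(p : K)‖) →
      ∀ z : Edwards.maxIdeal K,
        Edwards.WpConvergesAt (Edwards.g2 (d : K) x₁) (Edwards.g3 (d : K) x₁) (z.1 : K)) ∧
    -- whenever they converge there, the exponential map is defined and the sequence is exact
    ((∀ z : Edwards.maxIdeal K,
        Edwards.WpConvergesAt (Edwards.g2 (d : K) x₁) (Edwards.g3 (d : K) x₁) (z.1 : K)) →
      (∀ z : Edwards.maxIdeal K, z ≠ 0 →
        Edwards.wpDeriv (Edwards.g2 (d : K) x₁) (Edwards.g3 (d : K) x₁) (z.1 : K) ≠ 0 ∧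
        3 * Edwards.wp (Edwards.g2 (d : K) x₁) (Edwards.g3 (d : K) x₁) (z.1 : K)
          - Edwards.aPrime (d : K) x₁ + 3 * (x₁ : K) ≠ 0) ∧
      ∃ Exp : Edwards.maxIdeal K →+ Edwards.J0 (d : K) hd_sq,
        (∀ z : Edwards.maxIdeal K, z ≠ 0 →
          (Exp z).x = Edwards.expX (d : K) x₁ y₁ (z.1 : K) ∧
          (Exp z).y = Edwards.expY (d : K) x₁ (z.1 : K)) ∧
        Function.Injective Exp ∧
        Function.Exact Exp (Edwards.reduction hd_sq
          (Edwards.res_not_isSquare h2 (left_ne_zero_of_mul hd) hd_sq)) ∧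
        Function.Surjective (Edwards.reduction hd_sq
          (Edwards.res_not_isSquare h2 (left_ne_zero_of_mul hd) hd_sq))) := by
  have hn2 : ‖(2 : K)‖ = 1 := by
    exact_mod_cast Edwards.norm_natCast_eq_one_of_res_ne_zero (K := K) (n := 2)
      (by exact_mod_cast h2)
  have hnd : ‖(d : K)‖ ≤ 1 := Edwards.mem_ringOfIntegers.1 d.2
  have hnd1 : ‖1 - (d : K)‖ = 1 := by
    have h1 : Edwards.res (1 - d) ≠ 0 := by
      rw [map_sub, map_one, ← neg_sub, neg_ne_zero]
      exact right_ne_zero_of_mul hd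
    exact_mod_cast Edwards.norm_eq_one_of_res_ne_zero h1
  have hnx : ‖(x₁ : K)‖ = 1 := Edwards.norm_eq_one_of_res_ne_zero hx₁
  have hd0 : 1 - (d : K) ≠ 0 := norm_ne_zero_iff.1 (by simp [hnd1])
  have hx0 : (x₁ : K) ≠ 0 := norm_ne_zero_iff.1 (by simp [hnx])
  -- `κ` is the derivative at `0` of the first coordinate of `Exp`.
  obtain ⟨κ, hκdef⟩ : ∃ κ : K, κ = -(y₁ / x₁) := ⟨_, rfl⟩
  have hκ : κ ^ 2 * (1 - (d : K)) = 4 * x₁ := by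
    rw [eq_div_iff hd0] at hy₁
    rw [hκdef]
    field_simp
    linear_combination hy₁
  have hκ1 := Edwards.norm_eq_one_of_sq_mul_eq hn2 hnd1 hnx hκ
  refine ⟨fun hram z => ?_, fun hconv => ?_⟩
  · obtain ⟨r, hzr, hr1, hr⟩ := Edwards.exists_radius hram z
    have hr0 : 0 ≤ r := (norm_nonneg _).trans hzr.le
    exact Edwards.wpConvergesAt_of_mem_gaussUnitBall hr0
      (Edwards.xSeries_mem_gaussUnitBall hnd hnd1 hn2 hκ1 hκ hr0 hr1 hr) hzr (hzr.le.trans hr1)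
  obtain ⟨ϖ, hϖ⟩ := IsDiscreteValuationRing.exists_irreducible (Edwards.ringOfIntegers K)
  have hϖm : ϖ ∈ Edwards.maxIdeal K := (IsLocalRing.mem_maximalIdeal _).2 hϖ.not_isUnit
  have hdisc : ∀ x : K, ‖x‖ < 1 → ‖x‖ ≤ ‖(ϖ : K)‖ := by
    intro x hx
    have hxm : (⟨x, Edwards.mem_ringOfIntegers.2 hx.le⟩ : Edwards.ringOfIntegers K)
        ∈ Edwards.maxIdeal K := Edwards.mem_maxIdeal_iff.2 hx
    rw [Edwards.maxIdeal, hϖ.maximalIdeal_eq, Ideal.mem_span_singleton] at hxm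
    obtain ⟨w, hw⟩ := hxm
    have hw' : x = ϖ * w := congrArg Subtype.val hw
    rw [hw', norm_mul]
    exact mul_le_of_le_one_right (norm_nonneg _) (Edwards.mem_ringOfIntegers.1 w.2)
  have h : Edwards.ConvergentExp (d : K) x₁ κ ϖ :=
    { norm_two := hn2
      norm_d := hnd
      norm_one_sub := hnd1
      norm_x₁ := hnx
      kappa := hκ
      lt_one := Edwards.mem_maxIdeal_iff.1 hϖm
      discrete := hdisc
      converges := hconv ⟨ϖ, hϖm⟩ }
  have hz : ∀ z : Edwards.maxIdeal K, ‖(z.1 : K)‖ ≤ ‖(ϖ : K)‖ := fun z =>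
    hdisc _ (Edwards.mem_maxIdeal_iff.1 z.2)
  have hz0 : ∀ z : Edwards.maxIdeal K, z ≠ 0 → (z.1 : K) ≠ 0 := fun z hne h0 =>
    hne (Subtype.ext (Subtype.ext h0))
  let Exp : Edwards.maxIdeal K →+ Edwards.J0 (d : K) hd_sq :=
    AddMonoidHom.mk' (fun z => h.point hd_sq (hz z)) fun z w =>
      h.point_add (hz z) (hz w) (hz (z + w))
  refine ⟨fun z hne => ⟨h.wpDeriv_ne_zero (hz z) (hz0 z hne), h.wp_add_ne_zero (hz z) (hz0 z hne)⟩,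
    Exp, fun z hne => ⟨h.point_x_eq_expX (hz z) (hz0 z hne) hκdef,
      h.point_y_eq_expY (hz z) (hz0 z hne)⟩, ?_, ?_, Edwards.reduction_surjective h2 _ _⟩
  · rw [injective_iff_map_eq_zero]
    intro z hzE
    have h1 := h.norm_point_x (hd := hd_sq) (hz z)
    rw [show h.point hd_sq (hz z) = 0 from hzE, Edwards.zero_x, norm_zero, eq_comm,
      norm_eq_zero] at h1
    exact Subtype.ext (Subtype.ext h1)
  · intro P
    rw [Edwards.reduction_eq_zero_iff]
    constructor
    · rintro ⟨hPx, hPy⟩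
      obtain ⟨z, hzϖ, hzP⟩ := h.exists_point_x_eq (hd := hd_sq) (hdisc _ hPx)
      have hzlt : ‖z‖ < 1 := hzϖ.trans_lt h.lt_one
      refine ⟨⟨⟨z, Edwards.mem_ringOfIntegers.2 hzlt.le⟩, Edwards.mem_maxIdeal_iff.2 hzlt⟩, ?_⟩
      exact Edwards.eq_of_x_eq hn2 hzP (h.norm_point_y_sub_one hzϖ) hPy
    · rintro ⟨z, rfl⟩
      refine ⟨?_, h.norm_point_y_sub_one (hz z)⟩
      change ‖(h.point hd_sq (hz z)).x‖ < 1
      rw [h.norm_point_x]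
      exact (hz z).trans_lt h.lt_one
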